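/- Let $k\ge 2$ be an integer. For finite simple graphs $H,T$ ($T$ with at least one vertex) let $t(H,T)=\hom(H,T)/|V(T)|^{|V(H)|}$ be the homomorphism density, let $C_{2j}$ be the cycle on $2j$ vertices for $j\ge 2$, and let $C_2=K_2$ be a single edge. Let $\mathcal U=\{C_2,C_4,\dots,C_{2k}\}$ and let the density profile $\mathcal D_{\mathcal U}\subseteq\mathbb R^k$ be the closure of the set of all vectors $(t(C_2,T),t(C_4,T),\dots,t(C_{2k},T))$, where $T$ ranges over all finite graphs. For $b>1$ let $\log_b(\mathcal D_{\mathcal U})$ be the image of $\mathcal D_{\mathcal U}\cap\mathbb R_{>0}^k$ under the coordinatewise logarithm in base $b$, and let $\operatorname{trop}(\mathcal D_{\mathcal U})=\lim_{t\to0^+}\log_{1/t}(\mathcal D_{\mathcal U})$, the limit of sets in the sense of Painlevé–Kuratowski (the upper and the lower limit agree). Let $$Q_{\mathcal U}=\left\{(y_2,y_4,\dots,y_{2k})\in\mathbb R^k \;\middle|\; \begin{array}{l} y_{2i}-2y_{2i+2}+y_{2i+4}\ge0\quad(1\le i\le k-2),\\ 2k\,y_{2k-2}-(2k-2)\,y_{2k}\ge0,\\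 -2k\,y_2+y_{2k}\ge0\end{array}\right\}.$$ **Theorem.** The limit $\operatorname{trop}(\mathcal D_{\mathcal U})$ exists and $\operatorname{trop}(\mathcal D_{\mathcal U})=Q_{\mathcal U}$. Moreover, the extreme rays of the cone $Q_{\mathcal U}$ are exactly those spanned by $\mathbf s=(-1,-2,\dots,-k)$ and by $\mathbf r_i=(r_{i,2},r_{i,4},\dots,r_{i,2k})$ for $1\le i\le k-1$, where $$r_{i,2j}=\begin{cases}-i-(j-1)(2i+1)&\text{if }1\le j\le i+1,\\ -i\cdot 2j&\text{if }i+1\le j\le k.\end{cases}$$ They are realized as follows. 1. For $1\le i\le k-1$ let $T_{i,n}$ be the random bipartite graph with two parts of size $n^{i+1}$ in which every edge between the parts is present independently with probability $n^{-i}$. Then for every $\varepsilon>0$, with probability tending to $1$ as $n\to\infty$, all the densities $t(C_{2j},T_{i,n})$ are positive and $|\log_n t(C_{2j},T_{i,n})-r_{i,2j}|<\varepsilon$ for all $1\le j\le k$. 2. If $T_n$ is the graph on $n$ vertices with exactly one edge, then $(\log_n t(C_{2j},T_n))_{1\le j\le k}\to 2\,\mathbf s$ as $n\to\infty$. -/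

import Mathlib

open Filter Topology ProbabilityTheory

noncomputable section

/-- The homomorphism density `t(H, T) = hom(H, T) / |V(T)| ^ |V(H)|`. -/
def homDensity {V W : Type*} (H : SimpleGraph V) (T : SimpleGraph W) : ℝ :=
  (Nat.card (H →g T) : ℝ) / (Nat.card W : ℝ) ^ Nat.card V

/-- The graph density profile of a family `H` of graphs: the closure of the set of all vectors
`(t(H i, T))_i`, where `T` ranges over all finite graphs with at least one vertex. -/
def densityProfile {ι : Type*} {V : ι → Type*} (H : ∀ i, SimpleGraph (V i)) : Set (ι → ℝ) :=
  closure {v | ∃ n : ℕ, 0 < n ∧ ∃ T : SimpleGraph (Fin n), v = fun i => homDensity (H i) T}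

/-- `log_b S`: the image of `S ∩ ℝ_{>0}^ι` under the coordinatewise logarithm in base `b`. -/
def logImage {ι : Type*} (b : ℝ) (S : Set (ι → ℝ)) : Set (ι → ℝ) :=
  (fun v i => Real.logb b (v i)) '' {v ∈ S | ∀ i, 0 < v i}

/-- The (Painlevé–Kuratowski) upper limit of a family of sets along a filter. -/
def upperLimit {α X : Type*} [TopologicalSpace X] (l : Filter α) (A : α → Set X) : Set X :=
  {x | ∀ U ∈ 𝓝 x, ∃ᶠ a in l, (U ∩ A a).Nonempty}

/-- The (Painlevé–Kuratowski) lower limit of a family of sets along a filter. -/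
def lowerLimit {α X : Type*} [TopologicalSpace X] (l : Filter α) (A : α → Set X) : Set X :=
  {x | ∀ U ∈ 𝓝 x, ∀ᶠ a in l, (U ∩ A a).Nonempty}

/-- The sets `A a` converge to the set `L` along `l`. -/
def SetTendsto {α X : Type*} [TopologicalSpace X] (l : Filter α) (A : α → Set X) (L : Set X) :
    Prop :=
  upperLimit l A = L ∧ lowerLimit l A = L

/-- `trop(S) = L`, that is, the limit of the sets `log_{1/t} S` as `t → 0⁺` exists and is `L`. -/
def IsTropicalization {ι : Type*} (S L : Set (ι → ℝ)) : Prop :=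
  SetTendsto (𝓝[>] (0 : ℝ)) (fun t => logImage (1 / t) S) L

/-- The even cycle `C_{2j}`, where `C_2` is the graph consisting of a single edge. -/
def evenCycle (j : ℕ) : SimpleGraph (Fin (2 * j)) := SimpleGraph.cycleGraph (2 * j)

theorem evenCycle_one : evenCycle 1 = (⊤ : SimpleGraph (Fin 2)) :=
  SimpleGraph.cycleGraph_two_eq_top

/-- The family `{C_2, C_4, …, C_{2k}}`; the index `j : Fin k` stands for the cycle
`C_{2(j+1)}`. -/
def evenCycles (k : ℕ) (j : Fin k) : SimpleGraph (Fin (2 * (j.val + 1))) := evenCycle (j.val + 1)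

/-- The cone `Q_U`. The coordinate `y ⟨j, _⟩` is `y_{2(j+1)}`, so that
`y ⟨0, _⟩ = y_2`, `y ⟨k - 2, _⟩ = y_{2k-2}` and `y ⟨k - 1, _⟩ = y_{2k}`. -/
def evenCycleCone (k : ℕ) (hk : 2 ≤ k) : Set (Fin k → ℝ) :=
  {y | (∀ (j : ℕ) (hj : j + 2 < k),
          0 ≤ y ⟨j, by omega⟩ - 2 * y ⟨j + 1, by omega⟩ + y ⟨j + 2, hj⟩) ∧
    0 ≤ 2 * (k : ℝ) * y ⟨k - 2, by omega⟩ - (2 * (k : ℝ) - 2) * y ⟨k - 1, by omega⟩ ∧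
    0 ≤ -(2 * (k : ℝ)) * y ⟨0, by omega⟩ + y ⟨k - 1, by omega⟩}

/-- The vector `r_i`, whose coordinate belonging to `C_{2j}` is `-i - (j - 1)(2i + 1)` for
`j ≤ i + 1` and `-i · 2j` for `i + 1 ≤ j`. -/
def rayR (k i : ℕ) : Fin k → ℝ := fun m =>
  if m.val + 1 ≤ i + 1 then -(i : ℝ) - (m.val : ℝ) * (2 * i + 1)
  else -(i : ℝ) * (2 * ((m.val : ℝ) + 1))

/-- The vector `s = (-1, -2, …, -k)`. -/
def rayS (k : ℕ) : Fin k → ℝ := fun m => -((m.val : ℝ) + 1)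

/-- The ray spanned by a vector. -/
def raySpan {E : Type*} [SMul ℝ E] (v : E) : Set E := {x | ∃ c : ℝ, 0 ≤ c ∧ x = c • v}

/-- `R` is an extreme ray of the cone `Q`: a ray with a nonzero direction that is an extreme
subset (a face) of `Q`. -/
def IsExtremeRay {E : Type*} [AddCommGroup E] [Module ℝ E] (Q R : Set E) : Prop :=
  (∃ v : E, v ≠ 0 ∧ R = raySpan v) ∧ IsExtreme ℝ Q R

/-- The bipartite graph with parts `Fin N` and `Fin N` in which `a` and `b` are joined exactly
when `(a, b) ∈ S`. -/
def bipartiteGraph (N : ℕ) (S : Set (Fin N × Fin N)) : SimpleGraph (Fin N ⊕ Fin N) :=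
  SimpleGraph.fromRel fun x y => ∃ p ∈ S, x = Sum.inl p.1 ∧ y = Sum.inr p.2

/-- The number `n ^ (-i)`, as an element of the unit interval. -/
def edgeProb (n i : ℕ) : unitInterval :=
  ⟨((n ^ i : ℕ) : ℝ)⁻¹, inv_nonneg.2 (Nat.cast_nonneg _), Nat.cast_inv_le_one _⟩

/-- The law of the edge set of the random bipartite graph with parts of size `n ^ (i + 1)`
in which every edge is present independently with probability `n ^ (-i)`. -/
def randomEdges (n i : ℕ) :
    MeasureTheory.Measure (Set (Fin (n ^ (i + 1)) × Fin (n ^ (i + 1)))) :=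
  setBernoulli Set.univ (edgeProb n i)

/-- The graph on `n` vertices whose only edge is `{0, 1}` (for `2 ≤ n`). -/
def singleEdgeGraph (n : ℕ) : SimpleGraph (Fin n) :=
  SimpleGraph.fromRel fun a b => a.val = 0 ∧ b.val = 1

end

/-! Normalize the adjacency eigenvalues of `T` by the number `N` of vertices to get `x_i`. Then
`t(C_{2j}, T) = ∑ x_i ^ (2j)`, so Cauchy–Schwarz gives log-convexity and comparison of `ℓ^p` norms
gives the inequality between the last two coordinates. As `t(C_2, T)` is also the edge density, it
is a weighted mean of the `x_i` with weights at most one, and Jensen gives `t(C_2) ^ (2k) ≤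
t(C_{2k})`. These polynomial inequalities survive closure, and their logarithms are exactly the
inequalities of the cone. Hence every log image with base above one, and so the upper limit, lies in
the cone.

Conversely, the cone is simplicial: its `k` defining forms are, up to positive scalars, dual to `s,
r_1, …, r_{k-1}`. This identifies the extreme rays and writes each point as a nonnegative
combination of them. Tensor products multiply densities, so the lower limit is closed under
addition; changing the base of the logarithm makes it closed under positive scaling. It therefore
suffices to approach `2 s` and each `r_i` along integer bases.

A single edge gives `2 s`, its cycle counts being bounded. For `r_i`, closed walks of length `2j` in
the random bipartite graph are counted by their numbers `v` of vertices and `e` of edges. Either `v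
= e + 1` and every edge is repeated, so `e ≤ j`, or `v ≤ e`. The two cases contribute orders
`n^(i+1) n^j` and `n^(2j)` to the expected count, and their maximum is the kink in `r_i`. Markov's
inequality turns this into an upper bound. The lower bound is deterministic once there are enough
edges (Chebyshev): it is the power mean inequality before the kink and the Sidorenko inequality
after it. -/

noncomputable section

/-! ### Simplicial cones given by a biorthogonal system -/

section SimplicialCone

variable {ι E : Type*} [Fintype ι] [DecidableEq ι] [AddCommGroup E] [Module ℝ E]

theorem eq_sum_of_biorthogonal (L : ι → E →ₗ[ℝ] ℝ) (v : ι → E) (d : ι → ℝ)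
    (hinj : ∀ y, (∀ a, L a y = 0) → y = 0) (hd : ∀ a, 0 < d a)
    (hL : ∀ a b, L a (v b) = if a = b then d a else 0) (y : E) :
    y = ∑ a, (L a y / d a) • v a := by
  rw [← sub_eq_zero]
  apply hinj
  intro a
  simp [hL, (hd a).ne']

theorem raySpan_smul_of_pos {v : E} {c : ℝ} (hc : 0 < c) : raySpan (c • v) = raySpan v := by
  ext x
  constructor
  · rintro ⟨b, hb, rfl⟩
    exact ⟨b * c, by positivity, by rw [smul_smul]⟩
  · rintro ⟨b, hb, rfl⟩
    exact ⟨b / c, by positivity, by rw [smul_smul, div_mul_cancel₀ _ hc.ne']⟩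

/-- Up to positive scaling, the `L a` are the coordinates in the basis `v`, so the cone is an
orthant and its extreme rays are the coordinate axes. -/
theorem setOf_isExtremeRay_of_biorthogonal (L : ι → E →ₗ[ℝ] ℝ) (v : ι → E) (d : ι → ℝ)
    (hinj : ∀ y, (∀ a, L a y = 0) → y = 0) (hd : ∀ a, 0 < d a)
    (hL : ∀ a b, L a (v b) = if a = b then d a else 0) :
    {R | IsExtremeRay {y | ∀ a, 0 ≤ L a y} R} = {R | ∃ a, R = raySpan (v a)} := by
  have hexp := eq_sum_of_biorthogonal L v d hinj hd hL
  ext R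
  constructor
  · rintro ⟨⟨u, hu, rfl⟩, hR⟩
    have huR : u ∈ raySpan u := ⟨1, zero_le_one, (one_smul ℝ u).symm⟩
    have huQ : ∀ a, 0 ≤ L a u := hR.subset huR
    obtain ⟨a, ha⟩ : ∃ a, L a u ≠ 0 := by
      by_contra! h
      exact hu (hinj u h)
    have hpos : 0 < L a u := lt_of_le_of_ne (huQ a) (Ne.symm ha)
    -- `u` is the midpoint of twice its `v a`-component and twice the remainder, both in the cone;
    -- extremality then puts the first on the ray of `u`.
    have hx : (2 * (L a u / d a)) • v a ∈ {y | ∀ a, 0 ≤ L a y} := by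
      intro b
      have := hd a
      rw [map_smul, hL, smul_eq_mul]
      split_ifs with h
      · subst h; positivity
      · simp
    have hy : (2 : ℝ) • (u - (L a u / d a) • v a) ∈ {y | ∀ a, 0 ≤ L a y} := by
      intro b
      rw [map_smul, map_sub, map_smul, hL, smul_eq_mul, smul_eq_mul]
      split_ifs with h
      · subst h; simp [(hd b).ne']
      · simpa using huQ b
    obtain ⟨c, hc, hce⟩ := hR.left_mem_of_mem_openSegment hx hy huR
      ⟨1 / 2, 1 / 2, by norm_num, by norm_num, by norm_num, by module⟩
    have h2 : 0 < 2 * (L a u / d a) := by have := hd a; positivity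
    have hc0 : 0 < c := by
      refine lt_of_le_of_ne hc fun h => ?_
      have := congrArg (L a) hce
      rw [map_smul, hL, if_pos rfl, ← h, zero_smul, map_zero, smul_eq_mul] at this
      exact (mul_pos h2 (hd a)).ne' this
    refine ⟨a, ?_⟩
    rw [← raySpan_smul_of_pos hc0, ← hce, raySpan_smul_of_pos h2]
  · rintro ⟨a, rfl⟩
    refine ⟨⟨v a, fun h => ?_, rfl⟩, ?_, ?_⟩
    · have := hL a a
      rw [h, map_zero, if_pos rfl] at this
      exact (hd a).ne this
    · rintro _ ⟨c, hc, rfl⟩ b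
      have := hd b
      rw [map_smul, hL, smul_eq_mul]
      split_ifs <;> positivity
    · rintro x hx y hy _ ⟨c, hc, rfl⟩ ⟨α, β, hα, hβ, -, h⟩
      refine ⟨L a x / d a, div_nonneg (hx a) (hd a).le, ?_⟩
      conv_lhs => rw [hexp x]
      rw [Finset.sum_eq_single a _ (by simp)]
      -- On the axis of `v a` every other coordinate is zero; a positive combination of nonnegative
      -- numbers vanishes only if each does.
      intro b _ hb
      have h1 := congrArg (L b) h
      rw [map_add, map_smul, map_smul, map_smul, hL, if_neg hb, smul_zero, smul_eq_mul,
        smul_eq_mul] at h1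
      have h2 := mul_nonneg hα.le (hx b)
      have h3 := mul_nonneg hβ.le (hy b)
      have h4 : α * L b x = 0 := by linarith
      have h5 : L b x = 0 := (mul_eq_zero.1 h4).resolve_left hα.ne'
      rw [h5, zero_div, zero_smul]

end SimplicialCone

/-! ### The cone of even cycles -/

/-- The linear forms cutting out `evenCycleCone`; the form with index `a` is dual to the extreme
ray `coneRay k a`. -/
def coneForm (k : ℕ) (hk : 2 ≤ k) (a : Fin k) : (Fin k → ℝ) →ₗ[ℝ] ℝ :=
  if a.val = 0 then
    -(2 * (k : ℝ)) • LinearMap.proj ⟨0, by omega⟩ + LinearMap.proj ⟨k - 1, by omega⟩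
  else if h : a.val + 1 < k then
    LinearMap.proj ⟨a.val - 1, by omega⟩ - (2 : ℝ) • LinearMap.proj a
      + LinearMap.proj ⟨a.val + 1, h⟩
  else (2 * (k : ℝ)) • LinearMap.proj ⟨k - 2, by omega⟩
    - (2 * (k : ℝ) - 2) • LinearMap.proj ⟨k - 1, by omega⟩

/-- The generators of `evenCycleCone`. -/
def coneRay (k : ℕ) (a : Fin k) : Fin k → ℝ := if a.val = 0 then rayS k else rayR k a

theorem evenCycleCone_eq (k : ℕ) (hk : 2 ≤ k) :
    evenCycleCone k hk = {y | ∀ a, 0 ≤ coneForm k hk a y} := by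
  ext y
  constructor
  · rintro ⟨h1, h2, h3⟩ ⟨a, ha⟩
    unfold coneForm
    dsimp only
    split_ifs with h h'
    · simpa using h3
    · obtain ⟨j, rfl⟩ : ∃ j, a = j + 1 := ⟨a - 1, by omega⟩
      simpa using h1 j h'
    · simpa using h2
  · intro h
    refine ⟨fun j hj => ?_, ?_, ?_⟩
    · have := h ⟨j + 1, by omega⟩
      simpa [coneForm, hj] using this
    · have := h ⟨k - 1, by omega⟩
      have h0 : k - 1 ≠ 0 := by omega
      have h1 : ¬ (k - 1 + 1 < k) := by omega
      simpa [coneForm, h0, h1] using this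
    · simpa [coneForm] using h ⟨0, by omega⟩

/-- Vanishing second differences make `y` affine, `y_m = α + m β`. The form at the last index forces
`α = β`, and the one at index `0` then forces `k α = 0`. -/
theorem coneForm_injective (k : ℕ) (hk : 2 ≤ k) (y : Fin k → ℝ)
    (hy : ∀ a, coneForm k hk a y = 0) : y = 0 := by
  have h1 : ∀ (j : ℕ) (hj : j + 2 < k),
      y ⟨j, by omega⟩ - 2 * y ⟨j + 1, by omega⟩ + y ⟨j + 2, hj⟩ = 0 := fun j hj => by
    simpa [coneForm, hj] using hy ⟨j + 1, by omega⟩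
  have h2 : 2 * (k : ℝ) * y ⟨k - 2, by omega⟩ - (2 * (k : ℝ) - 2) * y ⟨k - 1, by omega⟩ = 0 := by
    have h0 : k - 1 ≠ 0 := by omega
    have h1 : ¬ (k - 1 + 1 < k) := by omega
    simpa [coneForm, h0, h1] using hy ⟨k - 1, by omega⟩
  have h3 : -(2 * (k : ℝ)) * y ⟨0, by omega⟩ + y ⟨k - 1, by omega⟩ = 0 := by
    simpa [coneForm] using hy ⟨0, by omega⟩
  have aff : ∀ m : ℕ, ∀ hm : m + 1 < k,
      y ⟨m, by omega⟩ = y ⟨0, by omega⟩ + m * (y ⟨1, by omega⟩ - y ⟨0, by omega⟩) ∧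
      y ⟨m + 1, hm⟩ = y ⟨0, by omega⟩ + (m + 1) * (y ⟨1, by omega⟩ - y ⟨0, by omega⟩) := by
    intro m
    induction m with
    | zero => intro hm; simp
    | succ m ih =>
      intro hm
      obtain ⟨e1, e2⟩ := ih (by omega)
      have := h1 m hm
      refine ⟨by rw [e2]; push_cast; ring, ?_⟩
      push_cast
      linarith
  obtain ⟨q, rfl⟩ : ∃ q, k = q + 2 := ⟨k - 2, by omega⟩
  obtain ⟨e1, e2⟩ := aff q (by omega)
  set α := y ⟨0, by omega⟩
  set β := y ⟨1, by omega⟩ - α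
  have i1 : q + 2 - 2 = q := by omega
  have i2 : q + 2 - 1 = q + 1 := by omega
  simp only [i1, i2, e1, e2] at h2 h3
  push_cast at h2 h3
  have hab : α = β := by linarith
  rw [← hab] at h3
  have hα : ((q : ℝ) + 2) * α = 0 := by linarith
  have hα0 : α = 0 := (mul_eq_zero.1 hα).resolve_left (by positivity)
  funext ⟨m, hm⟩
  rcases Nat.lt_or_ge (m + 1) (q + 2) with h | h
  · refine (aff m h).1.trans ?_
    change α + m * β = 0
    rw [← hab, hα0]; simp
  · obtain rfl : m = q + 1 := by omega
    rw [e2, ← hab, hα0]; simp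

/-- The value of the form `coneForm k hk a` at `coneRay k a`. -/
def coneScale (k : ℕ) (a : Fin k) : ℝ :=
  if a.val = 0 then k else if a.val + 1 < k then 1 else 2 * k

theorem coneScale_pos (k : ℕ) (hk : 2 ≤ k) (a : Fin k) : 0 < coneScale k a := by
  have : (0 : ℝ) < k := by exact_mod_cast (by omega : 0 < k)
  unfold coneScale
  split_ifs <;> positivity

/-- With indices starting at `0`, `r_b` has slope `-(2b+1)` up to index `b` and `-2b` afterwards, so
its only nonzero second difference is `1`, at `b`. Past the kink it is proportional to `m + 1`,
which kills the last form unless `b = k - 1`, where there is no kink in range. The vector `s` is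
linear in `m + 1`, so only the form with index `0` sees it. -/
theorem coneForm_coneRay (k : ℕ) (hk : 2 ≤ k) (a b : Fin k) :
    coneForm k hk a (coneRay k b) = if a = b then coneScale k a else 0 := by
  obtain ⟨q, rfl⟩ : ∃ q, k = q + 2 := ⟨k - 2, by omega⟩
  obtain ⟨a, ha⟩ := a
  obtain ⟨b, hb⟩ := b
  have i1 : q + 2 - 2 = q := by omega
  have i2 : q + 2 - 1 = q + 1 := by omega
  simp only [coneForm, coneRay, coneScale, Fin.mk.injEq, i1, i2]
  rcases Nat.eq_zero_or_pos a with rfl | ha0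
  · rcases Nat.eq_zero_or_pos b with rfl | hb0
    · simp [rayS]; ring
    · rw [if_pos rfl, if_neg hb0.ne', if_neg hb0.ne]
      simp only [LinearMap.add_apply, LinearMap.smul_apply, LinearMap.proj_apply, rayR,
        smul_eq_mul]
      rw [if_pos (by omega)]
      split_ifs with h
      · obtain rfl : b = q + 1 := by omega
        push_cast; ring
      · push_cast; ring
  · rw [if_neg ha0.ne', if_neg ha0.ne']
    rcases Nat.eq_zero_or_pos b with rfl | hb0
    · rw [if_pos rfl, if_neg ha0.ne']
      split_ifs with h
      · obtain ⟨a, rfl⟩ : ∃ c, a = c + 1 := ⟨a - 1, by omega⟩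
        simp [rayS]; ring
      · simp [rayS]; ring
    · rw [if_neg hb0.ne']
      by_cases h : a + 1 < q + 2
      · rw [dif_pos h, if_pos h]
        obtain ⟨a, rfl⟩ : ∃ c, a = c + 1 := ⟨a - 1, by omega⟩
        simp only [LinearMap.add_apply, LinearMap.sub_apply, LinearMap.smul_apply,
          LinearMap.proj_apply, rayR, smul_eq_mul, Nat.add_sub_cancel]
        split_ifs <;> first
          | omega
          | (push_cast; ring1)
          | (obtain rfl : b = a + 1 := by omega
             push_cast; ring1)
          | (obtain rfl : b = a := by omega
             push_cast; ring1)
      · rw [dif_neg h, if_neg h]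
        obtain rfl : a = q + 1 := by omega
        simp only [LinearMap.sub_apply, LinearMap.smul_apply,
          LinearMap.proj_apply, rayR, smul_eq_mul]
        split_ifs <;> first
          | omega
          | (subst b; push_cast; ring1)
          | (push_cast; ring1)
          | (obtain rfl : b = q := by omega
             push_cast; ring1)

theorem setOf_isExtremeRay_evenCycleCone (k : ℕ) (hk : 2 ≤ k) :
    {R | IsExtremeRay (evenCycleCone k hk) R} =
      {R | (∃ i : ℕ, 1 ≤ i ∧ i ≤ k - 1 ∧ R = raySpan (rayR k i)) ∨ R = raySpan (rayS k)} := by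
  rw [evenCycleCone_eq, setOf_isExtremeRay_of_biorthogonal (coneForm k hk) (coneRay k)
    (coneScale k) (coneForm_injective k hk) (coneScale_pos k hk) (coneForm_coneRay k hk)]
  ext R
  constructor
  · rintro ⟨⟨a, ha⟩, rfl⟩
    rcases Nat.eq_zero_or_pos a with rfl | h
    · right; simp [coneRay]
    · left; exact ⟨a, h, by omega, by simp [coneRay, h.ne']⟩
  · rintro (⟨i, h1, h2, rfl⟩ | rfl)
    · exact ⟨⟨i, by omega⟩, by simp [coneRay, show i ≠ 0 by omega]⟩
    · exact ⟨⟨0, by omega⟩, by simp [coneRay]⟩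

theorem eq_sum_coneRay (k : ℕ) (hk : 2 ≤ k) {y : Fin k → ℝ} (hy : y ∈ evenCycleCone k hk) :
    ∃ c : Fin k → ℝ, (∀ a, 0 ≤ c a) ∧ y = ∑ a, c a • coneRay k a := by
  rw [evenCycleCone_eq] at hy
  exact ⟨_, fun a => div_nonneg (hy a) (coneScale_pos k hk a).le,
    eq_sum_of_biorthogonal (coneForm k hk) (coneRay k) (coneScale k) (coneForm_injective k hk)
      (coneScale_pos k hk) (coneForm_coneRay k hk) y⟩

theorem isClosed_evenCycleCone (k : ℕ) (hk : 2 ≤ k) : IsClosed (evenCycleCone k hk) := by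
  have : evenCycleCone k hk = ⋂ a, {y | 0 ≤ coneForm k hk a y} := by
    rw [evenCycleCone_eq]; ext; simp
  rw [this]
  exact isClosed_iInter fun a =>
    isClosed_le continuous_const (LinearMap.continuous_of_finiteDimensional _)

/-! ### Homomorphisms from cycles and closed walks -/

section ClosedWalks

variable {W : Type*} [Fintype W]

/-- `g` lists the interior vertices of a walk from `u` to `v`: `Fin.cons u g` is the sequence of
sources of its steps and `Fin.snoc g v` the sequence of targets. -/
theorem Matrix.pow_succ_apply_eq_sum_walks {R : Type*} [CommSemiring R] [DecidableEq W]
    (M : Matrix W W R) (n : ℕ) (u v : W) :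
    (M ^ (n + 1)) u v = ∑ g : Fin n → W, ∏ a : Fin (n + 1),
      M (Fin.cons (α := fun _ => W) u g a) (Fin.snoc (α := fun _ => W) g v a) := by
  induction n generalizing u with
  | zero => simp [Fin.snoc]
  | succ n ih =>
    rw [pow_succ', Matrix.mul_apply, ← (Fin.consEquiv (fun _ : Fin (n + 1) => W)).sum_comp,
      Fintype.sum_prod_type]
    refine Finset.sum_congr rfl fun w _ => ?_
    rw [ih, Finset.mul_sum]
    refine Finset.sum_congr rfl fun g _ => ?_
    change _ = ∏ a, M (Fin.cons (α := fun _ => W) u (Fin.cons (α := fun _ => W) w g) a)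
      (Fin.snoc (α := fun _ => W) (Fin.cons (α := fun _ => W) w g) v a)
    rw [Fin.prod_univ_succ (n := n + 1), ← Fin.cons_snoc_eq_snoc_cons]
    simp only [Fin.cons_zero, Fin.cons_succ]

/-- When `u = v` the sequence of targets is the cyclic shift of the sequence of sources. -/
theorem Matrix.trace_pow_succ_eq_sum {R : Type*} [CommSemiring R] [DecidableEq W]
    (M : Matrix W W R) (n : ℕ) :
    (M ^ (n + 1)).trace = ∑ f : Fin (n + 1) → W, ∏ a, M (f a) (f (a + 1)) := by
  rw [← (Fin.consEquiv (fun _ : Fin (n + 1) => W)).sum_comp, Fintype.sum_prod_type]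
  refine Finset.sum_congr rfl fun u _ => ?_
  rw [Matrix.diag_apply, Matrix.pow_succ_apply_eq_sum_walks]
  refine Finset.sum_congr rfl fun g _ => Finset.prod_congr rfl fun a _ => ?_
  simp only [Fin.consEquiv_apply]
  congr 1
  induction a using Fin.lastCases with
  | last => simp
  | cast b => simp

/-- Homomorphisms from a cycle are closed walks. -/
def cycleHomEquiv (n : ℕ) (T : SimpleGraph W) :
    (SimpleGraph.cycleGraph (n + 2) →g T) ≃ {f : Fin (n + 2) → W // ∀ a, T.Adj (f a) (f (a + 1))}
    where
  toFun φ := ⟨φ, fun a => φ.map_adj (by rw [SimpleGraph.cycleGraph_adj]; simp)⟩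
  invFun f := ⟨f.1, fun {a b} h => by
    rw [SimpleGraph.cycleGraph_adj] at h
    rcases h with h | h
    · obtain rfl : a = b + 1 := by rw [← h]; abel
      exact (f.2 b).symm
    · obtain rfl : b = a + 1 := by rw [← h]; abel
      exact f.2 a⟩
  left_inv _ := rfl
  right_inv _ := rfl

theorem card_cycleHom_eq_sum (n : ℕ) (T : SimpleGraph W) [DecidableRel T.Adj] :
    (Nat.card (SimpleGraph.cycleGraph (n + 2) →g T) : ℝ) =
      ∑ f : Fin (n + 2) → W, ∏ a, if T.Adj (f a) (f (a + 1)) then (1 : ℝ) else 0 := by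
  classical
  rw [Nat.card_congr (cycleHomEquiv n T), Nat.card_eq_fintype_card, Fintype.card_subtype]
  simp [Finset.prod_ite_zero]

theorem card_cycleHom_eq_trace [DecidableEq W] (n : ℕ) (T : SimpleGraph W) [DecidableRel T.Adj] :
    (Nat.card (SimpleGraph.cycleGraph (n + 2) →g T) : ℝ) = (T.adjMatrix ℝ ^ (n + 2)).trace := by
  rw [card_cycleHom_eq_sum, Matrix.trace_pow_succ_eq_sum]
  rfl

end ClosedWalks

/-! ### Spectral description of the densities of even cycles -/

section Spectral

variable {W : Type*} [Fintype W]

theorem Matrix.IsHermitian.trace_pow_eq_sum [DecidableEq W] {A : Matrix W W ℝ}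
    (hA : A.IsHermitian) (n : ℕ) : (A ^ n).trace = ∑ i, hA.eigenvalues i ^ n := by
  conv_lhs => rw [hA.spectral_theorem, ← map_pow, Unitary.conjStarAlgAut_apply,
    Matrix.trace_mul_comm, ← mul_assoc]
  simp [Matrix.diagonal_pow, Matrix.trace_diagonal]

/-- `c` is the coordinate vector of the all-ones vector in an orthonormal eigenbasis; the sum of the
entries is the quadratic form at that vector. -/
theorem Matrix.IsHermitian.exists_sum_entries_eq [DecidableEq W] {A : Matrix W W ℝ}
    (hA : A.IsHermitian) : ∃ c : W → ℝ, ∑ i, c i ^ 2 = Fintype.card W ∧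
      ∑ u, ∑ v, A u v = ∑ i, c i ^ 2 * hA.eigenvalues i := by
  set U : Matrix W W ℝ := (hA.eigenvectorUnitary).1
  have hU : U * star U = 1 := Unitary.coe_mul_star_self _
  refine ⟨Matrix.vecMul 1 U, ?_, ?_⟩
  · have : Matrix.vecMul 1 U ⬝ᵥ Matrix.vecMul 1 U = (1 : W → ℝ) ⬝ᵥ 1 := by
      conv_lhs => rhs; rw [← Matrix.mulVec_transpose]
      rw [← Matrix.dotProduct_mulVec, Matrix.mulVec_mulVec]
      change 1 ⬝ᵥ (U * star U).mulVec 1 = _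
      rw [hU, Matrix.one_mulVec]
    simpa [dotProduct, sq] using this
  · have h1 : ∑ u, ∑ v, A u v = (1 : W → ℝ) ⬝ᵥ A.mulVec 1 := by
      simp [dotProduct, Matrix.mulVec]
    have h2 : A = U * Matrix.diagonal hA.eigenvalues * U.transpose := by
      conv_lhs => rw [hA.spectral_theorem, Unitary.conjStarAlgAut_apply]
      rfl
    rw [h1]
    conv_lhs => rw [h2, ← Matrix.mulVec_mulVec, ← Matrix.mulVec_mulVec, Matrix.mulVec_transpose,
      Matrix.dotProduct_mulVec]
    simp only [dotProduct, Matrix.mulVec_diagonal]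
    exact Finset.sum_congr rfl fun i _ => by ring

/-- The densities of the even cycles in `T` are the power sums of the normalized eigenvalues `x`;
moreover the edge density is a weighted average of the `x`. -/
theorem exists_homDensity_evenCycle_eq [Nonempty W] (T : SimpleGraph W) :
    ∃ x w : W → ℝ, (∀ j, homDensity (evenCycle (j + 1)) T = ∑ i, x i ^ (2 * (j + 1))) ∧
      (∀ i, 0 ≤ w i) ∧ ∑ i, w i = 1 ∧ homDensity (evenCycle 1) T = ∑ i, w i * x i := by
  classical
  have hA : (T.adjMatrix ℝ).IsHermitian := T.isHermitian_adjMatrix ℝ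
  obtain ⟨c, hc, hs⟩ := hA.exists_sum_entries_eq
  have hN : (Fintype.card W : ℝ) ≠ 0 := by exact_mod_cast Fintype.card_ne_zero
  have key : ∀ j, homDensity (evenCycle (j + 1)) T =
      (T.adjMatrix ℝ ^ (2 * (j + 1))).trace / (Fintype.card W : ℝ) ^ (2 * (j + 1)) := fun j => by
    rw [homDensity]
    congr 1
    · exact card_cycleHom_eq_trace (2 * j) T
    · simp
  refine ⟨fun i => hA.eigenvalues i / Fintype.card W, fun i => c i ^ 2 / Fintype.card W,
    fun j => ?_, fun i => by positivity, ?_, ?_⟩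
  · rw [key, hA.trace_pow_eq_sum]
    simp only [div_pow, Finset.sum_div]
  · rw [← Finset.sum_div, hc, div_self hN]
  -- The entries are `0` or `1` and the matrix is symmetric, so `C_2` is both the second moment of
  -- the spectrum and the sum of the entries.
  · have h2 : (T.adjMatrix ℝ ^ 2).trace = ∑ u, ∑ v, T.adjMatrix ℝ u v := by
      simp only [Matrix.trace, sq, Matrix.diag_apply, Matrix.mul_apply]
      refine Finset.sum_congr rfl fun u _ => Finset.sum_congr rfl fun v _ => ?_
      simp [SimpleGraph.adjMatrix_apply, T.adj_comm v u]
    rw [key 0]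
    simp only [zero_add, mul_one]
    rw [h2, hs, Finset.sum_div]
    exact Finset.sum_congr rfl fun i _ => by field_simp

/-- Log-convexity of the densities of even cycles. -/
theorem homDensity_evenCycle_sq_le [Nonempty W] (T : SimpleGraph W) (j : ℕ) :
    homDensity (evenCycle (j + 2)) T ^ 2 ≤
      homDensity (evenCycle (j + 1)) T * homDensity (evenCycle (j + 3)) T := by
  obtain ⟨x, w, hx, -⟩ := exists_homDensity_evenCycle_eq T
  rw [hx, hx, hx]
  have := Finset.sum_mul_sq_le_sq_mul_sq Finset.univ (fun i => x i ^ (j + 1))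
    (fun i => x i ^ (j + 3))
  calc (∑ i, x i ^ (2 * (j + 1 + 1))) ^ 2 = (∑ i, x i ^ (j + 1) * x i ^ (j + 3)) ^ 2 := by
        congr 1
        exact Finset.sum_congr rfl fun i _ => by ring
    _ ≤ (∑ i, (x i ^ (j + 1)) ^ 2) * ∑ i, (x i ^ (j + 3)) ^ 2 := this
    _ = _ := by
        congr 1 <;> exact Finset.sum_congr rfl fun i _ => by ring

/-- Monotonicity of the Schatten norms. -/
theorem homDensity_evenCycle_pow_le [Nonempty W] (T : SimpleGraph W) (j : ℕ) :
    homDensity (evenCycle (j + 2)) T ^ (j + 1) ≤ homDensity (evenCycle (j + 1)) T ^ (j + 2) := by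
  obtain ⟨x, w, hx, -⟩ := exists_homDensity_evenCycle_eq T
  rw [hx, hx]
  set S := ∑ i, x i ^ (2 * (j + 1))
  have hnn : ∀ i, 0 ≤ x i ^ (2 * (j + 1)) := fun i => by rw [pow_mul]; positivity
  have hS : 0 ≤ S := Finset.sum_nonneg fun i _ => hnn i
  -- `s` is the `ℓ^(j+1)` norm of the family `x_i ^ 2`, hence it dominates every `x_i ^ 2`.
  set s := S ^ (((j + 1 : ℕ) : ℝ)⁻¹)
  have hs : s ^ (j + 1) = S := Real.rpow_inv_natCast_pow hS (by omega)
  have hs0 : 0 ≤ s := Real.rpow_nonneg hS _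
  have hle : ∀ i, x i ^ 2 ≤ s := fun i => by
    refine le_of_pow_le_pow_left₀ (n := j + 1) (by omega) hs0 ?_
    rw [hs, ← pow_mul]
    exact Finset.single_le_sum (f := fun i => x i ^ (2 * (j + 1))) (fun i _ => hnn i)
      (Finset.mem_univ i)
  have hsum : ∑ i, x i ^ (2 * (j + 1 + 1)) ≤ s * S := by
    rw [Finset.mul_sum]
    refine Finset.sum_le_sum fun i _ => ?_
    have : x i ^ (2 * (j + 1 + 1)) = x i ^ 2 * x i ^ (2 * (j + 1)) := by ring
    rw [this]
    exact mul_le_mul_of_nonneg_right (hle i) (hnn i)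
  calc (∑ i, x i ^ (2 * (j + 1 + 1))) ^ (j + 1) ≤ (s * S) ^ (j + 1) := by
        gcongr
        exact Finset.sum_nonneg fun i _ => by rw [pow_mul]; positivity
    _ = S ^ (j + 2) := by rw [mul_pow, hs]; ring

/-- The Sidorenko property of even cycles. -/
theorem homDensity_evenCycle_one_pow_le [Nonempty W] (T : SimpleGraph W) (j : ℕ) :
    homDensity (evenCycle 1) T ^ (2 * (j + 1)) ≤ homDensity (evenCycle (j + 1)) T := by
  obtain ⟨x, w, hx, hw, hw1, hxw⟩ := exists_homDensity_evenCycle_eq T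
  rw [hxw, hx]
  -- Jensen for an even power, as the `x_i` may be negative; afterwards each weight is replaced by
  -- `1`.
  refine (Real.pow_arith_mean_le_arith_mean_pow_of_even Finset.univ w x (fun i _ => hw i) hw1
    (even_two_mul _)).trans (Finset.sum_le_sum fun i _ => ?_)
  refine mul_le_of_le_one_left (by rw [pow_mul]; positivity) ?_
  rw [← hw1]
  exact Finset.single_le_sum (f := w) (fun i _ => hw i) (Finset.mem_univ i)

/-- The power mean inequality for the eigenvalues. -/
theorem homDensity_evenCycle_one_pow_div_le [Nonempty W] (T : SimpleGraph W) (j : ℕ) :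
    homDensity (evenCycle 1) T ^ (j + 1) / (Fintype.card W : ℝ) ^ j ≤
      homDensity (evenCycle (j + 1)) T := by
  obtain ⟨x, w, hx, -⟩ := exists_homDensity_evenCycle_eq T
  rw [hx, hx]
  simp only [zero_add, pow_mul, pow_one]
  exact pow_sum_div_card_le_sum_pow (s := Finset.univ) (fun i _ => sq_nonneg (x i)) j

end Spectral

/-! ### The logarithmic image of the density profile lies in the cone -/

theorem densityProfile_evenCycles_subset (k : ℕ) (hk : 2 ≤ k) :
    densityProfile (evenCycles k) ⊆ {v | (∀ (j : ℕ) (hj : j + 2 < k),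
        v ⟨j + 1, by omega⟩ ^ 2 ≤ v ⟨j, by omega⟩ * v ⟨j + 2, hj⟩) ∧
      v ⟨k - 1, by omega⟩ ^ (k - 1) ≤ v ⟨k - 2, by omega⟩ ^ k ∧
      v ⟨0, by omega⟩ ^ (2 * k) ≤ v ⟨k - 1, by omega⟩} := by
  refine closure_minimal ?_ ?_
  · rintro _ ⟨n, hn, T, rfl⟩
    have : Nonempty (Fin n) := ⟨⟨0, hn⟩⟩
    obtain ⟨q, rfl⟩ : ∃ q, k = q + 2 := ⟨k - 2, by omega⟩
    exact ⟨fun j hj => homDensity_evenCycle_sq_le T j, homDensity_evenCycle_pow_le T q,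
      homDensity_evenCycle_one_pow_le T (q + 1)⟩
  · simp only [Set.ofPred_and, Set.ofPred_forall]
    refine IsClosed.inter (isClosed_iInter fun j => isClosed_iInter fun hj => ?_)
      (IsClosed.inter ?_ ?_)
    all_goals exact isClosed_le (by fun_prop) (by fun_prop)

theorem logImage_densityProfile_subset (k : ℕ) (hk : 2 ≤ k) {b : ℝ} (hb : 1 < b) :
    logImage b (densityProfile (evenCycles k)) ⊆ evenCycleCone k hk := by
  rintro _ ⟨v, ⟨hv, hpos⟩, rfl⟩
  obtain ⟨h1, h2, h3⟩ := densityProfile_evenCycles_subset k hk hv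
  refine ⟨fun j hj => ?_, ?_, ?_⟩
  · have := Real.logb_le_logb_of_le hb (pow_pos (hpos _) _) (h1 j hj)
    rw [Real.logb_pow, Real.logb_mul (hpos _).ne' (hpos _).ne'] at this
    push_cast at this
    linarith
  · have := Real.logb_le_logb_of_le hb (pow_pos (hpos _) _) h2
    rw [Real.logb_pow, Real.logb_pow, Nat.cast_sub (by omega)] at this
    push_cast at this
    linarith
  · have := Real.logb_le_logb_of_le hb (pow_pos (hpos _) _) h3
    rw [Real.logb_pow] at this
    push_cast at this
    linarith

/-! ### Painlevé–Kuratowski limits -/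

theorem eventually_one_lt_one_div : ∀ᶠ t : ℝ in 𝓝[>] 0, 1 < 1 / t := by
  filter_upwards [Ioo_mem_nhdsGT (zero_lt_one' ℝ)] with t ht
  exact one_lt_one_div ht.1 ht.2

theorem upperLimit_subset_of_isClosed {α X : Type*} [TopologicalSpace X] {l : Filter α}
    {A : α → Set X} {L : Set X} (hL : IsClosed L) (h : ∀ᶠ a in l, A a ⊆ L) :
    upperLimit l A ⊆ L := by
  intro x hx
  rw [← hL.closure_eq, mem_closure_iff_nhds]
  intro U hU
  obtain ⟨a, ha, hs⟩ := ((hx U hU).and_eventually h).exists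
  exact ha.mono (Set.inter_subset_inter_right U hs)

theorem lowerLimit_subset_upperLimit {α X : Type*} [TopologicalSpace X] {l : Filter α} [l.NeBot]
    {A : α → Set X} : lowerLimit l A ⊆ upperLimit l A := fun _ hx U hU => (hx U hU).frequently

theorem isClosed_lowerLimit {α X : Type*} [TopologicalSpace X] {l : Filter α} {A : α → Set X} :
    IsClosed (lowerLimit l A) := by
  rw [← closure_subset_iff_isClosed]
  intro x hx U hU
  obtain ⟨V, hVU, hV, hxV⟩ := mem_nhds_iff.1 hU
  obtain ⟨z, hzV, hz⟩ := mem_closure_iff.1 hx V hV hxV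
  exact (hz V (hV.mem_nhds hzV)).mono fun a ha => ha.mono (Set.inter_subset_inter_left _ hVU)

theorem lowerLimit_mono {α X : Type*} [TopologicalSpace X] {l : Filter α} {A B : α → Set X}
    (h : ∀ a, A a ⊆ B a) : lowerLimit l A ⊆ lowerLimit l B := fun _ hx U hU =>
  (hx U hU).mono fun a ha => ha.mono (Set.inter_subset_inter_right U (h a))

theorem add_mem_lowerLimit {α X : Type*} [TopologicalSpace X] [Add X] [ContinuousAdd X]
    {l : Filter α} {A : α → Set X} (hA : ∀ a, ∀ x ∈ A a, ∀ y ∈ A a, x + y ∈ A a) {x y : X}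
    (hx : x ∈ lowerLimit l A) (hy : y ∈ lowerLimit l A) : x + y ∈ lowerLimit l A := by
  intro U hU
  have h : (fun p : X × X => p.1 + p.2) ⁻¹' U ∈ 𝓝 (x, y) := continuous_add.continuousAt hU
  rw [nhds_prod_eq, Filter.mem_prod_iff] at h
  obtain ⟨V, hV, V', hV', hsub⟩ := h
  filter_upwards [hx V hV, hy V' hV'] with a ⟨u, hu, hua⟩ ⟨u', hu', hua'⟩
  exact ⟨u + u', hsub (Set.mk_mem_prod hu hu'), hA a u hua u' hua'⟩

/-! ### Multiplicativity of homomorphism densities -/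

/-- The tensor product of two graphs. -/
def tensorGraph {W W' : Type*} (T : SimpleGraph W) (T' : SimpleGraph W') :
    SimpleGraph (W × W') where
  Adj p q := T.Adj p.1 q.1 ∧ T'.Adj p.2 q.2
  symm := ⟨fun _ _ h => ⟨h.1.symm, h.2.symm⟩⟩
  loopless := ⟨fun _ h => h.1.ne rfl⟩

/-- The universal property of the tensor product. -/
def tensorGraphHomEquiv {V W W' : Type*} (H : SimpleGraph V) (T : SimpleGraph W)
    (T' : SimpleGraph W') : (H →g tensorGraph T T') ≃ (H →g T) × (H →g T') where
  toFun φ := (⟨fun x => (φ x).1, fun h => (φ.map_adj h).1⟩,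
    ⟨fun x => (φ x).2, fun h => (φ.map_adj h).2⟩)
  invFun p := ⟨fun x => (p.1 x, p.2 x), fun h => ⟨p.1.map_adj h, p.2.map_adj h⟩⟩
  left_inv _ := rfl
  right_inv _ := rfl

theorem homDensity_tensorGraph {V W W' : Type*} (H : SimpleGraph V) (T : SimpleGraph W)
    (T' : SimpleGraph W') :
    homDensity H (tensorGraph T T') = homDensity H T * homDensity H T' := by
  rw [homDensity, Nat.card_congr (tensorGraphHomEquiv H T T'), Nat.card_prod, Nat.card_prod]
  push_cast
  rw [mul_pow, ← div_mul_div_comm]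
  rfl

theorem homDensity_congr {V W W' : Type*} (H : SimpleGraph V) {T : SimpleGraph W}
    {T' : SimpleGraph W'} (e : T ≃g T') : homDensity H T = homDensity H T' := by
  rw [homDensity, homDensity, Nat.card_congr e.toEquiv]
  congr 2
  refine Nat.card_congr ⟨fun φ => e.toHom.comp φ, fun φ => e.symm.toHom.comp φ, fun φ => ?_,
    fun φ => ?_⟩ <;> ext <;> simp

/-- The vectors of homomorphism densities of finite graphs with at least one vertex. -/
def densityVectors {ι : Type*} {V : ι → Type*} (H : ∀ i, SimpleGraph (V i)) : Set (ι → ℝ) :=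
  {v | ∃ n : ℕ, 0 < n ∧ ∃ T : SimpleGraph (Fin n), v = fun i => homDensity (H i) T}

section DensityVectors

variable {ι : Type*} {V : ι → Type*} (H : ∀ i, SimpleGraph (V i))

theorem mem_densityVectors {W : Type*} [Finite W] [Nonempty W] (T : SimpleGraph W) :
    (fun i => homDensity (H i) T) ∈ densityVectors H := by
  refine ⟨Nat.card W, Nat.card_pos, T.map (Finite.equivFin W).toEmbedding, ?_⟩
  funext i
  exact homDensity_congr (H i) (SimpleGraph.Iso.map (Finite.equivFin W) T)

theorem mul_mem_densityVectors {v w : ι → ℝ} (hv : v ∈ densityVectors H)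
    (hw : w ∈ densityVectors H) : v * w ∈ densityVectors H := by
  obtain ⟨n, hn, T, rfl⟩ := hv
  obtain ⟨m, hm, T', rfl⟩ := hw
  have : Nonempty (Fin n) := ⟨⟨0, hn⟩⟩
  have : Nonempty (Fin m) := ⟨⟨0, hm⟩⟩
  convert mem_densityVectors H (tensorGraph T T') using 1
  funext i
  exact (homDensity_tensorGraph _ _ _).symm

theorem add_mem_logImage {S : Set (ι → ℝ)} (hS : ∀ v ∈ S, ∀ w ∈ S, v * w ∈ S) (b : ℝ)
    {x y : ι → ℝ} (hx : x ∈ logImage b S) (hy : y ∈ logImage b S) : x + y ∈ logImage b S := by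
  obtain ⟨v, ⟨hv, hvp⟩, rfl⟩ := hx
  obtain ⟨w, ⟨hw, hwp⟩, rfl⟩ := hy
  refine ⟨v * w, ⟨hS v hv w hw, fun i => mul_pos (hvp i) (hwp i)⟩, ?_⟩
  funext i
  exact Real.logb_mul (hvp i).ne' (hwp i).ne'

end DensityVectors

/-! ### Rescaling the base of the logarithm -/

theorem tendsto_logb_floor_rpow {c : ℝ} (hc : 0 < c) :
    Tendsto (fun b : ℝ => Real.logb b (⌊b ^ c⌋₊ : ℝ)) atTop (𝓝 c) := by
  have h1 : Tendsto (fun b : ℝ => (⌊b ^ c⌋₊ : ℝ) / b ^ c) atTop (𝓝 1) :=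
    (tendsto_nat_floor_div_atTop (R := ℝ)).comp (tendsto_rpow_atTop hc)
  have h2 : Tendsto (fun b : ℝ => Real.log ((⌊b ^ c⌋₊ : ℝ) / b ^ c) / Real.log b + c) atTop
      (𝓝 (0 + c)) :=
    ((h1.log one_ne_zero).div_atTop Real.tendsto_log_atTop).add_const c
  rw [zero_add] at h2
  refine h2.congr' ?_
  filter_upwards [eventually_gt_atTop 1] with b hb
  have hbc : 1 < b ^ c := Real.one_lt_rpow hb hc
  have hfl : ((⌊b ^ c⌋₊ : ℕ) : ℝ) ≠ 0 := by
    exact_mod_cast (Nat.floor_pos.2 hbc.le).ne'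
  have hlog : Real.log b ≠ 0 := (Real.log_pos hb).ne'
  rw [Real.log_div hfl (by positivity), Real.log_rpow (by linarith), Real.logb]
  field_simp
  ring

/-- For `n = ⌊(1/t)^c⌋` one has `log_{1/t} x = log_{1/t} n · log_n x`, and the first factor tends to
`c`. This passes from integer bases to all small `t` and gives arbitrary positive multiples. -/
theorem smul_mem_lowerLimit_logImage {ι : Type*} {S : Set (ι → ℝ)} {v : ι → ℝ}
    (hv : v ∈ lowerLimit atTop (fun n : ℕ => logImage n S)) {c : ℝ} (hc : 0 < c) :
    c • v ∈ lowerLimit (𝓝[>] (0 : ℝ)) (fun t => logImage (1 / t) S) := by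
  intro U hU
  have h : (fun p : ℝ × (ι → ℝ) => p.1 • p.2) ⁻¹' U ∈ 𝓝 (c, v) :=
    continuous_smul.continuousAt hU
  rw [nhds_prod_eq, Filter.mem_prod_iff] at h
  obtain ⟨A, hA, B, hB, hsub⟩ := h
  have hinv : Tendsto (fun t : ℝ => 1 / t) (𝓝[>] 0) atTop := by
    simpa only [one_div] using tendsto_inv_nhdsGT_zero (𝕜 := ℝ)
  have hfl : Tendsto (fun b : ℝ => ⌊b ^ c⌋₊) atTop atTop :=
    tendsto_nat_floor_atTop.comp (tendsto_rpow_atTop hc)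
  filter_upwards [eventually_one_lt_one_div, ((tendsto_logb_floor_rpow hc).comp hinv) hA,
    (hfl.comp hinv).eventually (hv B hB), (hfl.comp hinv).eventually (eventually_ge_atTop 2)]
    with t ht hat hbt hn
  obtain ⟨u, huB, w, hw, rfl⟩ := hbt
  refine ⟨_, hsub (Set.mk_mem_prod hat huB), w, hw, ?_⟩
  funext i
  simp only [Function.comp_apply] at hn ⊢
  have h2 : (2 : ℝ) ≤ (⌊(1 / t) ^ c⌋₊ : ℝ) := by exact_mod_cast hn
  simp only [Pi.smul_apply, smul_eq_mul]
  rw [Real.mul_logb] <;> linarith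

/-- Criterion for a cone to lie in the lower limit. -/
theorem sum_smul_mem_lowerLimit {ι κ : Type*} [Fintype κ] {S : Set (ι → ℝ)} [Nonempty κ]
    (hS : ∀ v ∈ S, ∀ w ∈ S, v * w ∈ S) {v : κ → ι → ℝ}
    (hv : ∀ a, ∀ c : ℝ, 0 < c →
      c • v a ∈ lowerLimit (𝓝[>] (0 : ℝ)) (fun t => logImage (1 / t) S))
    {c : κ → ℝ} (hc : ∀ a, 0 ≤ c a) :
    ∑ a, c a • v a ∈ lowerLimit (𝓝[>] (0 : ℝ)) (fun t => logImage (1 / t) S) := by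
  have h : ∀ a, ∀ c : ℝ, 0 ≤ c →
      c • v a ∈ lowerLimit (𝓝[>] (0 : ℝ)) (fun t => logImage (1 / t) S) := by
    intro a c hc
    -- Only positive multiples are given; a zero coefficient is reached as a limit, the lower limit
    -- being closed.
    have h0 : Tendsto (fun d : ℝ => (c + d) • v a) (𝓝[>] 0) (𝓝 ((c + 0) • v a)) :=
      (Continuous.tendsto (by fun_prop) _).mono_left nhdsWithin_le_nhds
    rw [add_zero] at h0
    refine isClosed_lowerLimit.mem_of_tendsto h0 ?_
    filter_upwards [self_mem_nhdsWithin] with d hd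
    exact hv a _ (add_pos_of_nonneg_of_pos hc hd)
  refine Finset.sum_induction_nonempty _ _
    (fun x y => add_mem_lowerLimit fun t x hx y hy => add_mem_logImage hS _ hx hy)
    Finset.univ_nonempty fun a _ => h a _ (hc a)

theorem isTropicalization_evenCycleCone (k : ℕ) (hk : 2 ≤ k)
    (hs : (2 : ℝ) • rayS k ∈
      lowerLimit atTop (fun n : ℕ => logImage n (densityVectors (evenCycles k))))
    (hr : ∀ i, 1 ≤ i → i ≤ k - 1 → rayR k i ∈
      lowerLimit atTop (fun n : ℕ => logImage n (densityVectors (evenCycles k)))) :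
    IsTropicalization (densityProfile (evenCycles k)) (evenCycleCone k hk) := by
  have hup : upperLimit (𝓝[>] (0 : ℝ)) (fun t => logImage (1 / t) (densityProfile (evenCycles k)))
      ⊆ evenCycleCone k hk :=
    upperLimit_subset_of_isClosed (isClosed_evenCycleCone k hk)
      (eventually_one_lt_one_div.mono fun t ht => logImage_densityProfile_subset k hk ht)
  have hlow : evenCycleCone k hk ⊆
      lowerLimit (𝓝[>] (0 : ℝ)) (fun t => logImage (1 / t) (densityProfile (evenCycles k))) := by
    intro y hy
    obtain ⟨c, hc, rfl⟩ := eq_sum_coneRay k hk hy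
    have : Nonempty (Fin k) := ⟨⟨0, by omega⟩⟩
    have hmono : ∀ t : ℝ, logImage (1 / t) (densityVectors (evenCycles k)) ⊆
        logImage (1 / t) (densityProfile (evenCycles k)) := fun t =>
      Set.image_mono fun v hv => ⟨subset_closure hv.1, hv.2⟩
    refine lowerLimit_mono hmono (sum_smul_mem_lowerLimit
      (fun v hv w hw => mul_mem_densityVectors _ hv hw) (fun a d hd => ?_) hc)
    unfold coneRay
    split_ifs with h
    · have := smul_mem_lowerLimit_logImage hs (half_pos hd)
      rwa [smul_smul, div_mul_cancel₀ _ two_ne_zero] at this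
    · exact smul_mem_lowerLimit_logImage (hr a (by omega) (by omega)) hd
  exact ⟨hup.antisymm (hlow.trans lowerLimit_subset_upperLimit),
    (lowerLimit_subset_upperLimit.trans hup).antisymm hlow⟩

/-! ### Graphs with a single edge -/

theorem singleEdgeGraph_adj_iff {n : ℕ} {a b : Fin n} : (singleEdgeGraph n).Adj a b ↔
    (a.val = 0 ∧ b.val = 1) ∨ (b.val = 0 ∧ a.val = 1) := by
  rw [singleEdgeGraph, SimpleGraph.fromRel_adj, and_iff_right_iff_imp]
  rintro h rfl
  omega

theorem one_le_card_hom_singleEdgeGraph {n : ℕ} (hn : 2 ≤ n) (j : ℕ) :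
    1 ≤ Nat.card (evenCycle (j + 1) →g singleEdgeGraph n) := by
  have : Nonempty (evenCycle (j + 1) →g singleEdgeGraph n) :=
    -- An even cycle is bipartite, so a two-colouring folds it onto the edge.
    ⟨SimpleGraph.Hom.comp
      (⟨fun x : Bool => bif x then ⟨1, by omega⟩ else ⟨0, by omega⟩, fun {x y} h => by
        rw [singleEdgeGraph_adj_iff]
        cases x <;> cases y <;> simp_all⟩ : (⊤ : SimpleGraph Bool) →g singleEdgeGraph n)
      (SimpleGraph.cycleGraph.bicoloring_of_even (2 * (j + 1)) (even_two_mul _))⟩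
  exact Nat.card_pos

/-- No vertex of the cycle is isolated, so each is sent to `0` or `1`, and a homomorphism is
determined by this binary choice. -/
theorem card_hom_singleEdgeGraph_le (n j : ℕ) :
    Nat.card (evenCycle (j + 1) →g singleEdgeGraph n) ≤ 2 ^ (2 * (j + 1)) := by
  have hval : ∀ (φ : evenCycle (j + 1) →g singleEdgeGraph n) a,
      (φ a).val = 0 ∨ (φ a).val = 1 := fun φ a => by
    have := (cycleHomEquiv (2 * j) _ φ).2 a
    rw [singleEdgeGraph_adj_iff] at this
    change ((φ a).val = 0 ∧ _) ∨ (_ ∧ (φ a).val = 1) at this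
    tauto
  have hinj : Function.Injective fun (φ : evenCycle (j + 1) →g singleEdgeGraph n) a =>
      decide ((φ a).val = 0) := fun φ ψ h => by
    ext a
    have := congrFun h a
    simp only [decide_eq_decide] at this
    have h1 := hval φ a
    have h2 := hval ψ a
    omega
  refine (Nat.card_le_card_of_injective _ hinj).trans ?_
  simp

/-- Logarithms in base `n` of quantities of constant order of magnitude tend to `0`. -/
theorem tendsto_logb_natCast_of_bounded {c : ℕ → ℝ} {A B : ℝ} (hA : 0 < A)
    (hAc : ∀ᶠ n in atTop, A ≤ c n) (hcB : ∀ᶠ n in atTop, c n ≤ B) :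
    Tendsto (fun n : ℕ => Real.logb n (c n)) atTop (𝓝 0) := by
  have hlog : Tendsto (fun n : ℕ => Real.log n) atTop atTop :=
    Real.tendsto_log_atTop.comp tendsto_natCast_atTop_atTop
  refine tendsto_of_tendsto_of_tendsto_of_le_of_le' (hlog.const_div_atTop (Real.log A))
    (hlog.const_div_atTop (Real.log B)) ?_ ?_
  · filter_upwards [hAc, hlog.eventually_gt_atTop 0] with n h hn
    exact div_le_div_of_nonneg_right (Real.log_le_log hA h) hn.le
  · filter_upwards [hAc, hcB, hlog.eventually_gt_atTop 0] with n h h' hn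
    exact div_le_div_of_nonneg_right (Real.log_le_log (hA.trans_le h) h') hn.le

theorem tendsto_logb_homDensity_singleEdgeGraph (k : ℕ) :
    Tendsto (fun n : ℕ => fun m : Fin k =>
        Real.logb n (homDensity (evenCycles k m) (singleEdgeGraph n)))
      atTop (𝓝 ((2 : ℝ) • rayS k)) := by
  rw [tendsto_pi_nhds]
  intro m
  have h := (tendsto_logb_natCast_of_bounded (c := fun n =>
      (Nat.card (evenCycle (m.val + 1) →g singleEdgeGraph n) : ℝ)) (A := 1)
      (B := 2 ^ (2 * (m.val + 1))) one_pos
    (by filter_upwards [eventually_ge_atTop 2] with n hn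
        exact_mod_cast one_le_card_hom_singleEdgeGraph hn m)
    (Eventually.of_forall fun n => by exact_mod_cast card_hom_singleEdgeGraph_le n m)).sub_const
      (2 * ((m.val : ℝ) + 1))
  have e : ((2 : ℝ) • rayS k) m = 0 - 2 * ((m.val : ℝ) + 1) := by
    simp [rayS]; ring
  rw [e]
  refine h.congr' ?_
  filter_upwards [eventually_ge_atTop 2] with n hn
  have h1 := one_le_card_hom_singleEdgeGraph hn m
  have hn' : (1 : ℝ) < n := by exact_mod_cast hn
  rw [evenCycles, homDensity, Nat.card_fin, Nat.card_fin,
    Real.logb_div (by positivity) (by positivity), Real.logb_pow, Real.logb_self_eq_one hn']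
  push_cast
  ring

theorem two_smul_rayS_mem_lowerLimit (k : ℕ) : (2 : ℝ) • rayS k ∈
    lowerLimit atTop (fun n : ℕ => logImage n (densityVectors (evenCycles k))) := by
  intro U hU
  filter_upwards [tendsto_logb_homDensity_singleEdgeGraph k hU, eventually_ge_atTop 2] with n h hn
  refine ⟨_, h, _, ⟨⟨n, by omega, singleEdgeGraph n, rfl⟩, fun m => ?_⟩, rfl⟩
  have h1 := one_le_card_hom_singleEdgeGraph hn m
  have h0 : (0 : ℝ) < n := by exact_mod_cast (by omega : 0 < n)
  rw [evenCycles, homDensity, Nat.card_fin, Nat.card_fin]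
  positivity

/-! ### Vertices and edges of closed walks -/

section WalkCounting

variable {V : Type*} [DecidableEq V]

/-- A step of a walk to a new vertex uses a new edge. -/
theorem card_vertices_le_card_edges_add_one (g : ℕ → V) (n : ℕ) :
    ((Finset.range (n + 1)).image g).card ≤
      ((Finset.range n).image fun a => s(g a, g (a + 1))).card + 1 := by
  induction n with
  | zero => simp
  | succ n ih =>
    have e1 : (Finset.range (n + 1 + 1)).image g =
        insert (g (n + 1)) ((Finset.range (n + 1)).image g) := by
      rw [Finset.range_add_one, Finset.image_insert]
    have e2 : ((Finset.range (n + 1)).image fun a => s(g a, g (a + 1))) =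
        insert s(g n, g (n + 1)) ((Finset.range n).image fun a => s(g a, g (a + 1))) := by
      rw [Finset.range_add_one, Finset.image_insert]
    rw [e1, e2]
    by_cases h : g (n + 1) ∈ (Finset.range (n + 1)).image g
    · rw [Finset.insert_eq_of_mem h]
      exact ih.trans (Nat.succ_le_succ (Finset.card_le_card (Finset.subset_insert _ _)))
    · rw [Finset.card_insert_of_notMem h, Finset.card_insert_of_notMem]
      · exact Nat.succ_le_succ ih
      · intro h'
        obtain ⟨a, ha, he⟩ := Finset.mem_image.1 h'
        have hmem : g (n + 1) ∈ s(g a, g (a + 1)) := he ▸ Sym2.mem_mk_right _ _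
        rw [Finset.mem_range] at ha
        rcases Sym2.mem_iff.1 hmem with h1 | h1
        · exact h (Finset.mem_image.2 ⟨a, Finset.mem_range.2 (by omega), h1.symm⟩)
        · exact h (Finset.mem_image.2 ⟨a + 1, Finset.mem_range.2 (by omega), h1.symm⟩)

/-- The edge set of the closed walk `f`. -/
def walkEdges {n : ℕ} (f : Fin (n + 1) → V) : Finset (Sym2 V) :=
  Finset.univ.image fun a => s(f a, f (a + 1))

/-- Omitting step `t` leaves an open walk that starts at `f (t + 1)` and still visits every vertex.
-/
theorem card_vertices_le_card_edges_erase {n : ℕ} (f : Fin (n + 1) → V) (t : Fin (n + 1)) :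
    (Finset.univ.image f).card ≤
      ((Finset.univ.erase t).image fun a => s(f a, f (a + 1))).card + 1 := by
  have h := card_vertices_le_card_edges_add_one (fun b => f (t + 1 + Fin.ofNat (n + 1) b)) n
  have hsucc : ∀ b : ℕ, Fin.ofNat (n + 1) (b + 1) = Fin.ofNat (n + 1) b + 1 := fun b => by
    ext; simp [Fin.val_add]
  refine le_trans (Finset.card_le_card ?_)
    (h.trans (Nat.succ_le_succ (Finset.card_le_card ?_)))
  · intro x hx
    obtain ⟨a, -, rfl⟩ := Finset.mem_image.1 hx
    refine Finset.mem_image.2 ⟨(a - (t + 1)).val, Finset.mem_range.2 (Fin.isLt _), ?_⟩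
    simp
  · intro x hx
    obtain ⟨b, hb, rfl⟩ := Finset.mem_image.1 hx
    rw [Finset.mem_range] at hb
    refine Finset.mem_image.2 ⟨t + 1 + Fin.ofNat (n + 1) b, ?_, ?_⟩
    · rw [Finset.mem_erase]
      refine ⟨fun h0 => ?_, Finset.mem_univ _⟩
      have h1 : Fin.ofNat (n + 1) (b + 1) = 0 := by
        rw [hsucc]
        have : t + (Fin.ofNat (n + 1) b + 1) = t + 0 := by
          rw [add_zero, add_comm (Fin.ofNat (n + 1) b), ← add_assoc, h0]
        exact add_left_cancel this
      have h2 := congrArg Fin.val h1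
      simp only [Fin.val_ofNat, Fin.val_zero] at h2
      rw [Nat.mod_eq_of_lt (by omega)] at h2
      omega
    · rw [hsucc, ← add_assoc]

/-- A closed walk is supported on a connected graph; either this graph contains a cycle or every
edge is traversed at least twice. -/
theorem card_vertices_closedWalk {n : ℕ} (f : Fin (n + 1) → V) :
    (Finset.univ.image f).card ≤ (walkEdges f).card + 1 ∧
      (2 * (walkEdges f).card ≤ n + 1 ∨ (Finset.univ.image f).card ≤ (walkEdges f).card) := by
  have hsub : ∀ t, ((Finset.univ.erase t).image fun a => s(f a, f (a + 1))) ⊆ walkEdges f :=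
    fun t => Finset.image_subset_image (Finset.erase_subset _ _)
  refine ⟨(card_vertices_le_card_edges_erase f 0).trans
    (Nat.succ_le_succ (Finset.card_le_card (hsub 0))), ?_⟩
  -- If some edge is traversed only once, omitting that step loses an edge but no vertex, which
  -- improves the bound by one.
  by_cases h : ∀ t, ∃ t', t' ≠ t ∧ s(f t', f (t' + 1)) = s(f t, f (t + 1))
  · left
    have := Finset.mul_card_image_le_card (f := fun a => s(f a, f (a + 1)))
      (Finset.univ : Finset (Fin (n + 1))) 2 (fun b hb => by
        obtain ⟨t, -, rfl⟩ := Finset.mem_image.1 hb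
        obtain ⟨t', hne, he⟩ := h t
        rw [Nat.succ_le_iff, Finset.one_lt_card]
        exact ⟨t', by simpa using he, t, by simp, hne⟩)
    simpa [walkEdges] using this
  · right
    push Not at h
    obtain ⟨t, ht⟩ := h
    refine (card_vertices_le_card_edges_erase f t).trans (Nat.succ_le_of_lt ?_)
    refine Finset.card_lt_card ((Finset.ssubset_iff_of_subset (hsub t)).2
      ⟨s(f t, f (t + 1)), Finset.mem_image_of_mem _ (Finset.mem_univ t), fun h' => ?_⟩)
    obtain ⟨a, ha, he⟩ := Finset.mem_image.1 h'
    exact ht a (Finset.ne_of_mem_erase ha) he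

/-- Such a map factors through `Fin v`: an enumeration of its image composed with a labelling of
`Fin m`. -/
theorem card_filter_card_image_eq_le [Fintype V] (m v : ℕ) :
    ((Finset.univ : Finset (Fin m → V)).filter fun f => (Finset.univ.image f).card = v).card ≤
      Fintype.card V ^ v * v ^ m := by
  have : ((Finset.univ : Finset (Fin m → V)).filter fun f => (Finset.univ.image f).card = v) ⊆
      (Finset.univ : Finset ((Fin v → V) × (Fin m → Fin v))).image fun p => p.1 ∘ p.2 := by
    intro f hf
    have hf := (Finset.mem_filter.1 hf).2
    let e := Finset.equivFinOfCardEq hf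
    refine Finset.mem_image.2 ⟨(fun i => (e.symm i).1,
      fun a => e ⟨f a, Finset.mem_image_of_mem f (Finset.mem_univ a)⟩), Finset.mem_univ _, ?_⟩
    funext a
    simp
  refine (Finset.card_le_card this).trans (Finset.card_image_le.trans ?_)
  simp

/-- Bound for a sum over all maps `Fin m → V` in terms of the sizes of their images. -/
theorem sum_le_of_card_image [Fintype V] [Nonempty V] {m : ℕ} {w : (Fin m → V) → ℝ} {B : ℝ}
    (hB : 0 ≤ B)
    (h : ∀ f, (Fintype.card V : ℝ) ^ (Finset.univ.image f).card * w f ≤ B) :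
    ∑ f, w f ≤ (m + 1) * m ^ m * B := by
  have hM : (0 : ℝ) < Fintype.card V := by exact_mod_cast Fintype.card_pos
  rw [← Finset.sum_fiberwise_of_maps_to (s := Finset.univ) (t := Finset.range (m + 1))
    (g := fun f : Fin m → V => (Finset.univ.image f).card) (fun f _ => Finset.mem_range.2
      (Nat.lt_succ_of_le (Finset.card_image_le.trans (by simp))))]
  have hv : ∀ v ∈ Finset.range (m + 1), (∑ f with (Finset.univ.image f).card = v, w f) ≤
      (m : ℝ) ^ m * B := by
    intro v hv
    have hvm : v ≤ m := Nat.lt_succ_iff.1 (Finset.mem_range.1 hv)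
    calc ∑ f with (Finset.univ.image f).card = v, w f
        ≤ ∑ f : Fin m → V with (Finset.univ.image f).card = v, B / (Fintype.card V : ℝ) ^ v := by
          refine Finset.sum_le_sum fun f hf => ?_
          rw [le_div_iff₀ (pow_pos hM v), mul_comm, ← (Finset.mem_filter.1 hf).2]
          exact h f
      _ = (((Finset.univ : Finset (Fin m → V)).filter
            fun f => (Finset.univ.image f).card = v).card : ℝ) *
            (B / (Fintype.card V : ℝ) ^ v) := by
          rw [Finset.sum_const, nsmul_eq_mul]
      _ ≤ ((Fintype.card V : ℝ) ^ v * (m : ℝ) ^ m) * (B / (Fintype.card V : ℝ) ^ v) := by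
          gcongr
          have h1 := card_filter_card_image_eq_le (V := V) m v
          have h2 : Fintype.card V ^ v * v ^ m ≤ Fintype.card V ^ v * m ^ m := by gcongr
          exact_mod_cast h1.trans h2
      _ = (m : ℝ) ^ m * B := by field_simp
  refine (Finset.sum_le_sum hv).trans ?_
  rw [Finset.sum_const, Finset.card_range, nsmul_eq_mul]
  push_cast
  linarith

/-- The expected number of closed walks of length `2 * l` when edges have probability `p`. -/
theorem sum_pow_card_walkEdges_le [Fintype V] [Nonempty V] {n l : ℕ} (hl : n + 1 = 2 * l)
    {p : ℝ} (hp0 : 0 ≤ p) (hp1 : p ≤ 1) (hVp : 1 ≤ Fintype.card V * p) :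
    ∑ f : Fin (n + 1) → V, p ^ (walkEdges f).card ≤
      ((n : ℝ) + 2) * ((n : ℝ) + 1) ^ (n + 1) *
        (Fintype.card V * (Fintype.card V * p) ^ l + (Fintype.card V * p) ^ (2 * l)) := by
  have hM : (0 : ℝ) ≤ Fintype.card V := by positivity
  have hB : 0 ≤ Fintype.card V * (Fintype.card V * p) ^ l + (Fintype.card V * p) ^ (2 * l) := by
    positivity
  have := sum_le_of_card_image (V := V) (m := n + 1)
    (w := fun f => p ^ (walkEdges f).card) hB fun f => ?_
  · refine this.trans (le_of_eq ?_)
    push_cast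
    ring
  · obtain ⟨h1, h2⟩ := card_vertices_closedWalk f
    have hv0 : 0 < (Finset.univ.image f).card :=
      Finset.card_pos.2 ⟨f 0, Finset.mem_image_of_mem _ (Finset.mem_univ _)⟩
    have hvm : (Finset.univ.image f).card ≤ 2 * l := by
      rw [← hl]; exact Finset.card_image_le.trans (by simp)
    -- More vertices than edges forces `v = e + 1` and `e ≤ l`, giving the first term; `v ≤ e` and
    -- `v ≤ 2 * l` give the second.
    rcases Nat.lt_or_ge (walkEdges f).card (Finset.univ.image f).card with h | h
    · have h3 : 2 * (walkEdges f).card ≤ n + 1 := by omega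
      have h4 : (Finset.univ.image f).card = (walkEdges f).card + 1 := by omega
      rw [h4, pow_succ', mul_assoc, ← mul_pow]
      have h5 : (Fintype.card V * p) ^ (walkEdges f).card ≤ (Fintype.card V * p) ^ l :=
        pow_le_pow_right₀ hVp (by omega)
      have h6 : 0 ≤ (Fintype.card V * p) ^ (2 * l) := by positivity
      have h7 := mul_le_mul_of_nonneg_left h5 hM
      linarith
    · have h5 : p ^ (walkEdges f).card ≤ p ^ (Finset.univ.image f).card :=
        pow_le_pow_of_le_one hp0 hp1 h
      have h6 : (Fintype.card V * p) ^ (Finset.univ.image f).card ≤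
          (Fintype.card V * p) ^ (2 * l) := pow_le_pow_right₀ hVp hvm
      rw [mul_pow] at h6
      have h7 : (Fintype.card V : ℝ) ^ (Finset.univ.image f).card * p ^ (walkEdges f).card ≤
          (Fintype.card V : ℝ) ^ (Finset.univ.image f).card * p ^ (Finset.univ.image f).card := by
        gcongr
      have h8 : 0 ≤ Fintype.card V * (Fintype.card V * p) ^ l := by positivity
      linarith

end WalkCounting

/-! ### Moments of the random bipartite graph -/

section Random

open MeasureTheory

theorem measureReal_setBernoulli_superset {α : Type*} [Finite α] (p : unitInterval)
    (F : Finset α) : (setBernoulli Set.univ p).real {S : Set α | ↑F ⊆ S} = (p : ℝ) ^ F.card := by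
  have h : (fun q : α → Prop => {i | q i}) ⁻¹' {S : Set α | ↑F ⊆ S} =
      Set.pi F fun _ => {True} := by
    ext q
    simp [Set.subset_def, Set.pi]
  rw [measureReal_def, setBernoulli_apply', h, Measure.infinitePi_pi _ (fun _ _ => by measurability)]
  simp

theorem bipartiteGraph_adj_iff {N : ℕ} {S : Set (Fin N × Fin N)} {u v : Fin N ⊕ Fin N} :
    (bipartiteGraph N S).Adj u v ↔ ∃ q ∈ S, s(Sum.inl q.1, Sum.inr q.2) = s(u, v) := by
  rw [bipartiteGraph, SimpleGraph.fromRel_adj]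
  constructor
  · rintro ⟨-, ⟨q, hq, rfl, rfl⟩ | ⟨q, hq, rfl, rfl⟩⟩
    · exact ⟨q, hq, rfl⟩
    · exact ⟨q, hq, Sym2.eq_swap⟩
  · rintro ⟨q, hq, h⟩
    rcases Sym2.eq_iff.1 h with ⟨rfl, rfl⟩ | ⟨rfl, rfl⟩
    · exact ⟨by simp, Or.inl ⟨q, hq, rfl, rfl⟩⟩
    · exact ⟨by simp, Or.inr ⟨q, hq, rfl, rfl⟩⟩

/-- If the event is possible at all, each edge of the walk comes from a pair in `Fin N × Fin N`, and
all these pairs must be selected. A walk that violates the bipartition has probability zero. -/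
theorem measureReal_closedWalk_le (N n : ℕ) (p : unitInterval)
    (f : Fin (n + 1) → Fin N ⊕ Fin N) :
    (setBernoulli Set.univ p).real
        {S : Set (Fin N × Fin N) | ∀ a, (bipartiteGraph N S).Adj (f a) (f (a + 1))} ≤
      (p : ℝ) ^ (walkEdges f).card := by
  classical
  rcases Set.eq_empty_or_nonempty
    {S : Set (Fin N × Fin N) | ∀ a, (bipartiteGraph N S).Adj (f a) (f (a + 1))} with h | ⟨S₀, h₀⟩
  · rw [h, measureReal_empty]
    exact pow_nonneg p.2.1 _
  · let F : Finset (Fin N × Fin N) :=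
      Finset.univ.filter fun q => s(Sum.inl q.1, Sum.inr q.2) ∈ walkEdges f
    have hF : (walkEdges f).card ≤ F.card := by
      refine Finset.card_le_card_of_surjOn (fun q => s(Sum.inl q.1, Sum.inr q.2)) fun e he => ?_
      obtain ⟨a, -, rfl⟩ := Finset.mem_image.1 he
      obtain ⟨q, -, hq⟩ := bipartiteGraph_adj_iff.1 (h₀ a)
      exact ⟨q, by simpa [F, hq] using he, hq⟩
    calc _ ≤ (setBernoulli Set.univ p).real {S : Set (Fin N × Fin N) | ↑F ⊆ S} := by
          refine measureReal_mono fun S hS q hq => ?_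
          have hq' : s(Sum.inl q.1, Sum.inr q.2) ∈ walkEdges f := by simpa [F] using hq
          obtain ⟨a, -, ha⟩ := Finset.mem_image.1 hq'
          obtain ⟨q', hq'S, hq'e⟩ := bipartiteGraph_adj_iff.1 (hS a)
          have : q' = q := by
            rw [ha] at hq'e
            rcases Sym2.eq_iff.1 hq'e with ⟨h1, h2⟩ | ⟨h1, h2⟩
            · exact Prod.ext (Sum.inl_injective h1) (Sum.inr_injective h2)
            · simp at h1
          exact this ▸ hq'S
      _ = (p : ℝ) ^ F.card := measureReal_setBernoulli_superset p F
      _ ≤ _ := pow_le_pow_of_le_one p.2.1 p.2.2 hF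

theorem integral_card_cycleHom_le (N n : ℕ) (p : unitInterval) :
    ∫ S : Set (Fin N × Fin N),
        (Nat.card (SimpleGraph.cycleGraph (n + 2) →g bipartiteGraph N S) : ℝ)
        ∂(setBernoulli Set.univ p) ≤
      ∑ f : Fin (n + 2) → Fin N ⊕ Fin N, (p : ℝ) ^ (walkEdges f).card := by
  classical
  have h : ∀ S : Set (Fin N × Fin N),
      (Nat.card (SimpleGraph.cycleGraph (n + 2) →g bipartiteGraph N S) : ℝ) =
        ∑ f : Fin (n + 2) → Fin N ⊕ Fin N,
          {S : Set (Fin N × Fin N) | ∀ a, (bipartiteGraph N S).Adj (f a) (f (a + 1))}.indicator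
            1 S := fun S => by
    rw [card_cycleHom_eq_sum]
    refine Finset.sum_congr rfl fun f _ => ?_
    rw [Finset.prod_ite_zero, Set.indicator_apply]
    simp
  simp_rw [h]
  rw [integral_finsetSum _ fun f _ => Integrable.of_finite]
  refine Finset.sum_le_sum fun f _ => ?_
  rw [integral_indicator_one (MeasurableSet.of_discrete)]
  exact measureReal_closedWalk_le N (n + 1) p f

/-- This is the variance bound for a binomial variable: distinct pairs of elements contribute `p ^
2`, and the diagonal costs at most an extra `p` per element. -/
theorem integral_sq_ncard_sub_le {α : Type*} [Fintype α] (p : unitInterval) :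
    ∫ S : Set α, ((S.ncard : ℝ) - Fintype.card α * p) ^ 2 ∂(setBernoulli Set.univ p) ≤
      Fintype.card α * p := by
  classical
  set P : Measure (Set α) := setBernoulli Set.univ p
  set M : ℝ := Fintype.card α * p
  have h1 : ∀ S : Set α, (S.ncard : ℝ) = ∑ q, {S : Set α | q ∈ S}.indicator (1 : Set α → ℝ) S := by
    intro S
    rw [Set.ncard_eq_toFinset_card']
    simp [Set.indicator_apply, Finset.sum_boole]
  have h2 : ∀ S : Set α, (S.ncard : ℝ) ^ 2 =
      ∑ q, ∑ q', {S : Set α | q ∈ S ∧ q' ∈ S}.indicator (1 : Set α → ℝ) S := by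
    intro S
    rw [sq, h1, Finset.sum_mul_sum]
    refine Finset.sum_congr rfl fun q _ => Finset.sum_congr rfl fun q' _ => ?_
    simp only [Set.indicator_apply, Set.mem_ofPred_eq, Pi.one_apply, ite_and]
    split_ifs <;> simp
  have i1 : ∫ S : Set α, (S.ncard : ℝ) ∂P = M := by
    simp_rw [h1]
    rw [integral_finsetSum _ fun f _ => Integrable.of_finite]
    have : ∀ q : α, ∫ S : Set α, {S : Set α | q ∈ S}.indicator (1 : Set α → ℝ) S ∂P = p := by
      intro q
      rw [integral_indicator_one (MeasurableSet.of_discrete)]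
      simpa using measureReal_setBernoulli_superset p {q}
    simp [this, M]
  have i2 : ∫ S : Set α, (S.ncard : ℝ) ^ 2 ∂P ≤ M ^ 2 + M := by
    simp_rw [h2]
    rw [integral_finsetSum _ fun f _ => Integrable.of_finite]
    have : ∀ q q' : α, ∫ S : Set α, {S : Set α | q ∈ S ∧ q' ∈ S}.indicator (1 : Set α → ℝ) S ∂P ≤
        (p : ℝ) ^ 2 + if q = q' then (p : ℝ) else 0 := by
      intro q q'
      rw [integral_indicator_one (MeasurableSet.of_discrete)]
      have h := measureReal_setBernoulli_superset p {q, q'}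
      have e : {S : Set α | (({q, q'} : Finset α) : Set α) ⊆ S} = {S | q ∈ S ∧ q' ∈ S} := by
        ext S; simp [Set.insert_subset_iff]
      rw [e] at h
      rw [h]
      split_ifs with hq
      · subst hq
        simp [sq_nonneg]
      · rw [Finset.card_pair hq, add_zero]
    calc _ = ∑ q, ∑ q', ∫ S : Set α, {S : Set α | q ∈ S ∧ q' ∈ S}.indicator (1 : Set α → ℝ) S ∂P :=
          Finset.sum_congr rfl fun q _ => integral_finsetSum _ fun f _ => Integrable.of_finite
      _ ≤ ∑ q : α, ∑ q' : α, ((p : ℝ) ^ 2 + if q = q' then (p : ℝ) else 0) :=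
          Finset.sum_le_sum fun q _ => Finset.sum_le_sum fun q' _ => this q q'
      _ = M ^ 2 + M := by
          simp [Finset.sum_add_distrib, M]
          ring
  have e : ∀ S : Set α, ((S.ncard : ℝ) - M) ^ 2 = (S.ncard : ℝ) ^ 2 - 2 * M * S.ncard + M ^ 2 :=
    fun S => by ring
  simp_rw [e]
  rw [integral_add Integrable.of_finite Integrable.of_finite,
    integral_sub Integrable.of_finite Integrable.of_finite, integral_const_mul, i1]
  simp
  linarith

/-- The number of edges of the random graph is rarely less than half of its mean. -/
theorem measureReal_ncard_lt_half_le {α : Type*} [Fintype α] (p : unitInterval)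
    (hp : 0 < Fintype.card α * (p : ℝ)) :
    (setBernoulli Set.univ p).real {S : Set α | (S.ncard : ℝ) < Fintype.card α * p / 2} ≤
      4 / (Fintype.card α * p) := by
  set M : ℝ := Fintype.card α * p
  -- Chebyshev's inequality: Markov for the squared deviation at the threshold `(M / 2) ^ 2`.
  have h := mul_meas_ge_le_integral_of_nonneg (μ := setBernoulli Set.univ p)
    (f := fun S : Set α => ((S.ncard : ℝ) - M) ^ 2) (Eventually.of_forall fun S => sq_nonneg _)
    Integrable.of_finite (M ^ 2 / 4)
  have h2 : (setBernoulli Set.univ p).real {S : Set α | (S.ncard : ℝ) < M / 2} ≤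
      (setBernoulli Set.univ p).real {S : Set α | M ^ 2 / 4 ≤ ((S.ncard : ℝ) - M) ^ 2} := by
    refine measureReal_mono fun S hS => ?_
    have hS : (S.ncard : ℝ) < M / 2 := hS
    change M ^ 2 / 4 ≤ ((S.ncard : ℝ) - M) ^ 2
    nlinarith
  refine h2.trans ?_
  rw [le_div_iff₀ hp]
  have h3 := h.trans (integral_sq_ncard_sub_le p)
  have h4 : M * ((setBernoulli Set.univ p).real
      {S : Set α | M ^ 2 / 4 ≤ ((S.ncard : ℝ) - M) ^ 2} * M) ≤ M * 4 := by
    linarith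
  exact le_of_mul_le_mul_left h4 hp

theorem ncard_le_card_hom_bipartiteGraph (N : ℕ) (S : Set (Fin N × Fin N)) :
    S.ncard ≤ Nat.card (evenCycle 1 →g bipartiteGraph N S) := by
  rw [← Nat.card_coe_set_eq]
  have hadj : ∀ q ∈ S, (bipartiteGraph N S).Adj (Sum.inl q.1) (Sum.inr q.2) := fun q hq =>
    bipartiteGraph_adj_iff.2 ⟨q, hq, rfl⟩
  refine Nat.card_le_card_of_injective (fun q : S => (cycleHomEquiv 0 _).symm
    ⟨![Sum.inl q.1.1, Sum.inr q.1.2], fun a => ?_⟩) fun q q' h => ?_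
  · fin_cases a
    · exact hadj q.1 q.2
    · exact (hadj q.1 q.2).symm
  · have h := congrArg Subtype.val ((cycleHomEquiv 0 _).symm.injective h)
    have h0 := congrFun h 0
    have h1 := congrFun h 1
    simp only [Matrix.cons_val_zero, Matrix.cons_val_one] at h0 h1
    exact Subtype.ext (Prod.ext (Sum.inl_injective h0) (Sum.inr_injective h1))

end Random

/-! ### Asymptotics of the densities of even cycles in the random bipartite graph -/

section RandomAsymptotics

open MeasureTheory

instance (n i : ℕ) : IsProbabilityMeasure (randomEdges n i) :=
  inferInstanceAs (IsProbabilityMeasure (setBernoulli Set.univ (edgeProb n i)))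

/-- The constant in the upper bound for the expected density of the cycle of length
`2 * (j + 1)`. -/
def cycleConst (j : ℕ) : ℝ := 2 * (2 * j + 3) * (2 * j + 2) ^ (2 * j + 2)

theorem cycleConst_pos (j : ℕ) : 0 < cycleConst j := by
  unfold cycleConst
  positivity

theorem coe_edgeProb (n i : ℕ) : (edgeProb n i : ℝ) = ((n : ℝ) ^ i)⁻¹ := by
  simp [edgeProb]

/-- Scaled by `N ^ (2j)` with `N = n ^ (i + 1)` and `j = m + 1`, the prediction `n ^ r_{i,2j}` is
the larger of the two walk counts `N n ^ j` and `n ^ (2j)`; they cross at `j = i + 1`. -/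
theorem rpow_rayR_mul {k i n : ℕ} (hn : 0 < n) (m : Fin k) :
    (n : ℝ) ^ rayR k i m * ((n : ℝ) ^ (i + 1)) ^ (2 * (m.val + 1)) =
      if m.val ≤ i then (n : ℝ) ^ (i + 1) * (n : ℝ) ^ (m.val + 1)
      else (n : ℝ) ^ (2 * (m.val + 1)) := by
  have hn0 : (0 : ℝ) < n := by exact_mod_cast hn
  rw [← pow_mul, ← Real.rpow_natCast, ← Real.rpow_add hn0, rayR]
  simp only [add_le_add_iff_right]
  split_ifs
  · rw [← pow_add, ← Real.rpow_natCast]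
    congr 1
    push_cast
    ring
  · rw [← Real.rpow_natCast]
    congr 1
    push_cast
    ring

theorem integral_homDensity_evenCycles_le {k i n : ℕ} (hn : 0 < n) (m : Fin k) :
    ∫ S, homDensity (evenCycles k m) (bipartiteGraph (n ^ (i + 1)) S) ∂(randomEdges n i) ≤
      cycleConst m * (n : ℝ) ^ rayR k i m := by
  obtain ⟨j, hj⟩ := m
  have hn1 : (1 : ℝ) ≤ n := by exact_mod_cast hn
  have hn0 : (0 : ℝ) < n := by linarith
  set N := n ^ (i + 1) with hN
  have hNr : (N : ℝ) = (n : ℝ) ^ (i + 1) := by rw [hN]; push_cast; rfl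
  have hN0 : 0 < N := pow_pos hn _
  have : Nonempty (Fin N) := ⟨⟨0, hN0⟩⟩
  -- There are `2 * N` vertices in all, hence the factor `2`; it is absorbed later by the
  -- denominator `(2 * N) ^ (2 * (j + 1))`.
  have hVp : (Fintype.card (Fin N ⊕ Fin N) : ℝ) * edgeProb n i = 2 * n := by
    rw [coe_edgeProb, Fintype.card_sum, Fintype.card_fin]
    push_cast
    rw [hNr]
    field_simp
    ring
  have hsum := sum_pow_card_walkEdges_le (V := Fin N ⊕ Fin N) (n := 2 * j + 1) (l := j + 1)
    (by ring) (edgeProb n i).2.1 (edgeProb n i).2.2 (by rw [hVp]; linarith)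
  rw [hVp] at hsum
  have hE := (integral_card_cycleHom_le N (2 * j) (edgeProb n i)).trans hsum
  have hd : ∀ S : Set (Fin N × Fin N), homDensity (evenCycles k ⟨j, hj⟩) (bipartiteGraph N S) =
      (Nat.card (SimpleGraph.cycleGraph (2 * j + 2) →g bipartiteGraph N S) : ℝ) /
        (2 * (N : ℝ)) ^ (2 * (j + 1)) := fun S => by
    rw [homDensity, Nat.card_eq_fintype_card (α := Fin N ⊕ Fin N), Fintype.card_sum,
      Fintype.card_fin, Nat.card_fin, ← two_mul]
    push_cast
    rfl
  refine (integral_congr_ae (Eventually.of_forall hd)).trans_le ?_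
  rw [integral_div, div_le_iff₀ (by positivity)]
  refine hE.trans ?_
  have hr := rpow_rayR_mul (k := k) (i := i) hn ⟨j, hj⟩
  dsimp only at hr
  rw [← hNr] at hr
  have hmax : (N : ℝ) * (n : ℝ) ^ (j + 1) ≤ (n : ℝ) ^ rayR k i ⟨j, hj⟩ * (N : ℝ) ^ (2 * (j + 1)) ∧
      (n : ℝ) ^ (2 * (j + 1)) ≤ (n : ℝ) ^ rayR k i ⟨j, hj⟩ * (N : ℝ) ^ (2 * (j + 1)) := by
    rw [hr]
    split_ifs with h
    · refine ⟨le_rfl, ?_⟩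
      rw [hNr, ← pow_add]
      exact pow_le_pow_right₀ hn1 (by omega)
    · refine ⟨?_, le_rfl⟩
      rw [hNr, ← pow_add]
      exact pow_le_pow_right₀ hn1 (by omega)
  set X := (n : ℝ) ^ rayR k i ⟨j, hj⟩ * (N : ℝ) ^ (2 * (j + 1)) with hX
  have h2 : (2 : ℝ) ^ (j + 2) ≤ 2 ^ (2 * (j + 1)) := pow_le_pow_right₀ one_le_two (by omega)
  have hcard : (Fintype.card (Fin N ⊕ Fin N) : ℝ) = 2 * N := by
    rw [Fintype.card_sum, Fintype.card_fin]; push_cast; ring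
  have hX0 : 0 ≤ X := by positivity
  have hb : (Fintype.card (Fin N ⊕ Fin N) : ℝ) * (2 * n) ^ (j + 1) + (2 * (n : ℝ)) ^ (2 * (j + 1)) ≤
      2 * (2 ^ (2 * (j + 1)) * X) := by
    rw [hcard, mul_pow, mul_pow]
    have e : 2 * (N : ℝ) * (2 ^ (j + 1) * (n : ℝ) ^ (j + 1)) =
        2 ^ (j + 2) * (N * (n : ℝ) ^ (j + 1)) := by ring
    rw [e]
    have h3 : (2 : ℝ) ^ (j + 2) * (N * (n : ℝ) ^ (j + 1)) ≤ 2 ^ (2 * (j + 1)) * X :=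
      mul_le_mul h2 hmax.1 (by positivity) (by positivity)
    have h4 : (2 : ℝ) ^ (2 * (j + 1)) * (n : ℝ) ^ (2 * (j + 1)) ≤ 2 ^ (2 * (j + 1)) * X :=
      mul_le_mul_of_nonneg_left hmax.2 (by positivity)
    linarith
  refine (mul_le_mul_of_nonneg_left hb (by positivity)).trans (le_of_eq ?_)
  rw [hX, cycleConst, mul_pow]
  push_cast
  ring

/-- The bound on the edge density propagates to all cycles: by the power mean inequality for `m ≤ i`
and by the Sidorenko inequality for `m > i`. -/
theorem le_homDensity_evenCycles_bipartiteGraph {k i n N : ℕ} (hn : 0 < n)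
    (hN : N = n ^ (i + 1)) (m : Fin k) {S : Set (Fin N × Fin N)} (hS : (n : ℝ) ^ (i + 2) / 2 ≤ S.ncard) :
    (1 / 8) ^ (2 * (m.val + 1)) * (n : ℝ) ^ rayR k i m ≤
      homDensity (evenCycles k m) (bipartiteGraph N S) := by
  obtain ⟨j, hj⟩ := m
  have hn0 : (0 : ℝ) < n := by exact_mod_cast hn
  have hr := rpow_rayR_mul (k := k) (i := i) hn ⟨j, hj⟩
  dsimp only at hr ⊢
  have hNr : (N : ℝ) = (n : ℝ) ^ (i + 1) := by rw [hN]; push_cast; rfl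
  have : Nonempty (Fin N) := ⟨⟨0, hN ▸ pow_pos hn _⟩⟩
  have hN0 : (0 : ℝ) < N := by rw [hNr]; positivity
  -- `1 / 8` is the `1 / 2` from the edge count over the `4` from `(2 * N) ^ 2`.
  have h1 : 1 / 8 * ((n : ℝ) ^ i)⁻¹ ≤ homDensity (evenCycle 1) (bipartiteGraph N S) := by
    have h := ncard_le_card_hom_bipartiteGraph N S
    have h' : (S.ncard : ℝ) ≤ Nat.card (evenCycle 1 →g bipartiteGraph N S) := by exact_mod_cast h
    rw [homDensity, Nat.card_eq_fintype_card (α := Fin N ⊕ Fin N), Fintype.card_sum,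
      Fintype.card_fin, Nat.card_fin]
    push_cast
    rw [le_div_iff₀ (by positivity)]
    refine le_trans (le_of_eq ?_) (hS.trans h')
    rw [hNr]
    field_simp
    ring
  rw [← hNr] at hr
  have hr' : (n : ℝ) ^ rayR k i ⟨j, hj⟩ = (if j ≤ i then (N : ℝ) * (n : ℝ) ^ (j + 1)
      else (n : ℝ) ^ (2 * (j + 1))) / (N : ℝ) ^ (2 * (j + 1)) := by
    rw [← hr]; field_simp
  rw [hr']
  split_ifs with h
  · refine le_trans ?_ (homDensity_evenCycle_one_pow_div_le (bipartiteGraph N S) j)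
    have h2 : (1 / 8 * ((n : ℝ) ^ i)⁻¹) ^ (j + 1) / (Fintype.card (Fin N ⊕ Fin N) : ℝ) ^ j ≤
        homDensity (evenCycle 1) (bipartiteGraph N S) ^ (j + 1) /
          (Fintype.card (Fin N ⊕ Fin N) : ℝ) ^ j := by gcongr
    refine le_trans ?_ h2
    have e : (N : ℝ) * (n : ℝ) ^ (j + 1) / (N : ℝ) ^ (2 * (j + 1)) =
        (((n : ℝ) ^ i)⁻¹) ^ (j + 1) / (N : ℝ) ^ j := by
      rw [hNr, inv_pow]
      field_simp
      ring
    have hcard : (Fintype.card (Fin N ⊕ Fin N) : ℝ) = 2 * N := by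
      rw [Fintype.card_sum, Fintype.card_fin]; push_cast; ring
    rw [e, hcard, mul_pow, mul_pow, mul_div_mul_comm]
    gcongr
    rw [two_mul (j + 1), pow_add, div_eq_mul_inv ((1 / 8 : ℝ) ^ (j + 1))]
    gcongr
    rw [← inv_pow]
    calc (1 / 8 : ℝ) ^ (j + 1) ≤ (1 / 8) ^ j :=
          pow_le_pow_of_le_one (by norm_num) (by norm_num) (by omega)
      _ ≤ 2⁻¹ ^ j := by gcongr; norm_num
  · refine le_trans ?_ (homDensity_evenCycle_one_pow_le (bipartiteGraph N S) j)
    refine le_trans (le_of_eq ?_) (pow_le_pow_left₀ (by positivity) h1 _)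
    rw [mul_pow, hNr]
    rw [← div_pow]
    congr 2
    field_simp
    ring

/-- The random graph rarely has few edges or many closed walks. -/
theorem measureReal_randomEdges_bad_le {k i n : ℕ} (hn : 0 < n) (δ : ℝ) :
    (randomEdges n i).real {S | ¬ ((n : ℝ) ^ (i + 2) / 2 ≤ S.ncard ∧ ∀ m : Fin k,
      homDensity (evenCycles k m) (bipartiteGraph (n ^ (i + 1)) S) <
        cycleConst m * (n : ℝ) ^ rayR k i m * (n : ℝ) ^ δ)} ≤
      4 / (n : ℝ) ^ (i + 2) + k * (n : ℝ) ^ (-δ) := by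
  have hn0 : (0 : ℝ) < n := by exact_mod_cast hn
  have hmean : (Fintype.card (Fin (n ^ (i + 1)) × Fin (n ^ (i + 1))) : ℝ) * edgeProb n i =
      (n : ℝ) ^ (i + 2) := by
    rw [coe_edgeProb, Fintype.card_prod, Fintype.card_fin]
    push_cast
    field_simp
    ring
  have h1 := measureReal_ncard_lt_half_le (α := Fin (n ^ (i + 1)) × Fin (n ^ (i + 1)))
    (edgeProb n i) (by rw [hmean]; positivity)
  rw [hmean] at h1
  -- Markov's inequality at `n ^ δ` times the bound for the expectation.
  have h2 : ∀ m : Fin k, (randomEdges n i).real {S |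
      cycleConst m * (n : ℝ) ^ rayR k i m * (n : ℝ) ^ δ ≤
        homDensity (evenCycles k m) (bipartiteGraph (n ^ (i + 1)) S)} ≤ (n : ℝ) ^ (-δ) := by
    intro m
    have hc := cycleConst_pos m
    have h := (mul_meas_ge_le_integral_of_nonneg (μ := randomEdges n i)
      (f := fun S => homDensity (evenCycles k m) (bipartiteGraph (n ^ (i + 1)) S))
      (Eventually.of_forall fun S => by simp only [Pi.zero_apply, homDensity]; positivity)
      Integrable.of_finite
      (cycleConst m * (n : ℝ) ^ rayR k i m * (n : ℝ) ^ δ)).trans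
      (integral_homDensity_evenCycles_le hn m)
    have hpos : 0 < cycleConst m * (n : ℝ) ^ rayR k i m := by positivity
    rw [Real.rpow_neg hn0.le, ← one_div, le_div_iff₀ (by positivity)]
    refine le_of_mul_le_mul_left ?_ hpos
    linarith
  have hsub : {S | ¬ ((n : ℝ) ^ (i + 2) / 2 ≤ S.ncard ∧ ∀ m : Fin k,
      homDensity (evenCycles k m) (bipartiteGraph (n ^ (i + 1)) S) <
        cycleConst m * (n : ℝ) ^ rayR k i m * (n : ℝ) ^ δ)} ⊆
      {S | (S.ncard : ℝ) < (n : ℝ) ^ (i + 2) / 2} ∪ ⋃ m : Fin k, {S |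
        cycleConst m * (n : ℝ) ^ rayR k i m * (n : ℝ) ^ δ ≤
        homDensity (evenCycles k m) (bipartiteGraph (n ^ (i + 1)) S)} := by
    intro S hS
    simp only [Set.mem_ofPred_eq, not_and_or, not_le, not_forall, not_lt] at hS
    simpa using hS
  calc _ ≤ _ := measureReal_mono hsub
    _ ≤ _ := measureReal_union_le _ _
    _ ≤ 4 / (n : ℝ) ^ (i + 2) + ∑ m : Fin k, (n : ℝ) ^ (-δ) :=
        add_le_add h1 ((measureReal_iUnion_fintype_le _).trans
          (Finset.sum_le_sum fun m _ => h2 m))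
    _ = _ := by simp

/-- Constant factors vanish in base-`n` logarithms. The upper tolerance `ε` is split in halves,
between the Markov factor `n ^ (ε / 2)` and `cycleConst`. -/
theorem tendsto_randomEdges_rayR (k i : ℕ) {ε : ℝ} (hε : 0 < ε) :
    Tendsto (fun n : ℕ => randomEdges n i {S | ∀ m : Fin k,
        0 < homDensity (evenCycles k m) (bipartiteGraph (n ^ (i + 1)) S) ∧
        |Real.logb n (homDensity (evenCycles k m) (bipartiteGraph (n ^ (i + 1)) S))
          - rayR k i m| < ε})
      atTop (𝓝 1) := by
  have hlow : ∀ᶠ n : ℕ in atTop, ∀ m : Fin k,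
      -ε < Real.logb n ((1 / 8) ^ (2 * (m.val + 1))) := eventually_all.2 fun m =>
    (tendsto_logb_natCast_of_bounded (c := fun _ => (1 / 8) ^ (2 * (m.val + 1)))
      (A := (1 / 8) ^ (2 * (m.val + 1))) (by positivity) (Eventually.of_forall fun _ => le_rfl)
      (Eventually.of_forall fun _ => le_rfl)).eventually (lt_mem_nhds (neg_lt_zero.2 hε))
  have hup : ∀ᶠ n : ℕ in atTop, ∀ m : Fin k, Real.logb n (cycleConst m) < ε / 2 :=
    eventually_all.2 fun m =>
    (tendsto_logb_natCast_of_bounded (c := fun _ => cycleConst m)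
      (cycleConst_pos m) (Eventually.of_forall fun _ => le_rfl)
      (Eventually.of_forall fun _ => le_rfl)).eventually (gt_mem_nhds (half_pos hε))
  have hβ : Tendsto (fun n : ℕ => 1 - (4 / (n : ℝ) ^ (i + 2) + k * (n : ℝ) ^ (-(ε / 2)))) atTop
      (𝓝 (1 - (0 + k * 0))) := by
    refine tendsto_const_nhds.sub (Tendsto.add ?_ (Tendsto.const_mul _ ?_))
    · exact ((tendsto_pow_atTop (by omega)).comp tendsto_natCast_atTop_atTop).const_div_atTop 4
    · exact (tendsto_rpow_neg_atTop (half_pos hε)).comp tendsto_natCast_atTop_atTop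
  simp only [mul_zero, add_zero, sub_zero] at hβ
  have hreal : Tendsto (fun n : ℕ => (randomEdges n i).real {S | ∀ m : Fin k,
        0 < homDensity (evenCycles k m) (bipartiteGraph (n ^ (i + 1)) S) ∧
        |Real.logb n (homDensity (evenCycles k m) (bipartiteGraph (n ^ (i + 1)) S))
          - rayR k i m| < ε}) atTop (𝓝 1) := by
    refine tendsto_of_tendsto_of_tendsto_of_le_of_le' hβ tendsto_const_nhds ?_
      (Eventually.of_forall fun n => measureReal_le_one)
    filter_upwards [hlow, hup, eventually_ge_atTop 2] with n hl hu hn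
    have hn1 : (1 : ℝ) < n := by exact_mod_cast hn
    have hn0 : (0 : ℝ) < n := by linarith
    have hbad := measureReal_randomEdges_bad_le (k := k) (i := i) (by omega : 0 < n) (ε / 2)
    set G : Set (Set (Fin (n ^ (i + 1)) × Fin (n ^ (i + 1)))) :=
      {S | (n : ℝ) ^ (i + 2) / 2 ≤ S.ncard ∧ ∀ m : Fin k,
        homDensity (evenCycles k m) (bipartiteGraph (n ^ (i + 1)) S) <
          cycleConst m * (n : ℝ) ^ rayR k i m * (n : ℝ) ^ (ε / 2)}
    have hG : 1 - (4 / (n : ℝ) ^ (i + 2) + k * (n : ℝ) ^ (-(ε / 2))) ≤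
        (randomEdges n i).real G := by
      have := probReal_compl_eq_one_sub (μ := randomEdges n i) (s := G) MeasurableSet.of_discrete
      change (randomEdges n i).real Gᶜ ≤ _ at hbad
      linarith
    refine hG.trans (measureReal_mono fun S hS m => ?_)
    have h1 := le_homDensity_evenCycles_bipartiteGraph (k := k) (by omega : 0 < n) rfl m hS.1
    have h2 := hS.2 m
    have hc := cycleConst_pos m
    have hpos : 0 < homDensity (evenCycles k m) (bipartiteGraph (n ^ (i + 1)) S) :=
      lt_of_lt_of_le (by positivity) h1
    refine ⟨hpos, ?_⟩
    have h3 := Real.logb_le_logb_of_le hn1 (by positivity) h1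
    have h4 := Real.logb_lt_logb hn1 hpos h2
    rw [Real.logb_mul (by positivity) (by positivity), Real.logb_rpow hn0 hn1.ne'] at h3
    rw [Real.logb_mul (by positivity) (by positivity), Real.logb_mul (by positivity)
      (by positivity), Real.logb_rpow hn0 hn1.ne', Real.logb_rpow hn0 hn1.ne'] at h4
    rw [abs_lt]
    constructor <;> linarith [hl m, hu m]
  have := ENNReal.tendsto_ofReal hreal
  rw [ENNReal.ofReal_one] at this
  exact this.congr fun n => ENNReal.ofReal_toReal (measure_ne_top _ _)

/-- The probabilistic method: an event of positive probability contains a graph. -/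
theorem rayR_mem_lowerLimit (k i : ℕ) : rayR k i ∈
    lowerLimit atTop (fun n : ℕ => logImage n (densityVectors (evenCycles k))) := by
  intro U hU
  obtain ⟨ε, hε, hball⟩ := Metric.mem_nhds_iff.1 hU
  filter_upwards [(tendsto_randomEdges_rayR k i hε).eventually (lt_mem_nhds zero_lt_one),
    eventually_gt_atTop 0] with n h hn
  obtain ⟨S, hS⟩ := nonempty_of_measure_ne_zero h.ne'
  have : Nonempty (Fin (n ^ (i + 1))) := ⟨⟨0, pow_pos hn _⟩⟩
  refine ⟨_, hball ?_, _, ⟨mem_densityVectors (evenCycles k) (bipartiteGraph (n ^ (i + 1)) S),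
    fun m => (hS m).1⟩, rfl⟩
  rw [Metric.mem_ball, dist_pi_lt_iff hε]
  exact fun m => (hS m).2

end RandomAsymptotics

end

theorem mainTheorem5 (k : ℕ) (hk : 2 ≤ k) :
    -- the tropicalization of the density profile of `{C_2, C_4, …, C_{2k}}` is the cone `Q_U`
    IsTropicalization (densityProfile (evenCycles k)) (evenCycleCone k hk) ∧
    -- the extreme rays of the cone are those spanned by `r_1, …, r_{k-1}` and `s`
    {R | IsExtremeRay (evenCycleCone k hk) R} =
      {R | (∃ i : ℕ, 1 ≤ i ∧ i ≤ k - 1 ∧ R = raySpan (rayR k i)) ∨ R = raySpan (rayS k)} ∧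
    -- `r_i` is realized by the sparse random bipartite graphs: for every `ε > 0`, with
    -- probability tending to `1`, the vector `(log_n t(C_{2j}, T))_j` is within `ε` of `r_i`
    (∀ i : ℕ, 1 ≤ i → i ≤ k - 1 → ∀ ε : ℝ, 0 < ε →
      Tendsto (fun n : ℕ => randomEdges n i {S | ∀ m : Fin k,
          0 < homDensity (evenCycles k m) (bipartiteGraph (n ^ (i + 1)) S) ∧
          |Real.logb n (homDensity (evenCycles k m) (bipartiteGraph (n ^ (i + 1)) S))
            - rayR k i m| < ε})
        atTop (𝓝 1)) ∧
    -- the ray spanned by `s` is realized by the graphs with a single edge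
    Tendsto (fun n : ℕ => fun m : Fin k =>
        Real.logb n (homDensity (evenCycles k m) (singleEdgeGraph n)))
      atTop (𝓝 ((2 : ℝ) • rayS k)) :=
  ⟨isTropicalization_evenCycleCone k hk (two_smul_rayS_mem_lowerLimit k)
      fun i _ _ => rayR_mem_lowerLimit k i,
    setOf_isExtremeRay_evenCycleCone k hk,
    fun i _ _ _ hε => tendsto_randomEdges_rayR k i hε,
    tendsto_logb_homDensity_singleEdgeGraph k⟩
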